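/- Let $\Omega=(\mathbb R/\mathbb Z)^2$ be the periodic unit square, $\nu>0$, $T>0$, $I=(0,T)$, $Q=\Omega\times I$, $\|\cdot\|=\|\cdot\|_{L^2(\Omega)}$, $\operatorname{rot}\varphi=(\partial_2\varphi,-\partial_1\varphi)$. Let $u\in L^\infty(Q)^2$ be a velocity field, $\omega_h\in L^\infty(I;W^{1,\infty}(\Omega))$ and $\xi_0\in H^1(\Omega)$. Here and below $f\in L^\infty(I;W^{1,\infty}(\Omega))$ means that $f$ and its weak spatial gradient $\nabla f$ are in $L^\infty(Q)$. **Flow time scale.** For $\bar u\in[L^\infty(I;W^{1,\infty}(\Omega))]^2$ put $u'=u-\bar u$ and $$\Lambda(\bar u,u',\nu)=\nabla_S\bar u-\tfrac12(\nabla\cdot\bar u)\,\mathcal I_{2\times2}+\tfrac1{2\nu}\,u'\otimes u',$$ where $\nabla_S$ is the symmetric part of the gradient, and let $\sigma_p^+(\Lambda)$ be the largest positive eigenvalue of $\Lambda$ (zero if there is none). Define $\tau_F\in[0,\infty]$ by $$\tau_F^{-1}=\inf_{\bar u\in[L^\infty(I;W^{1,\infty}(\Omega))]^2}\|\sigma_p^+(\Lambda(\bar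 u,u',\nu))\|_{L^\infty(Q)} .$$ **Dual problem.** Let $(\varphi_1,\varphi_2)$, with $\varphi_1\in H^1(I;L^2(\Omega))\cap L^2(I;H^2(\Omega))$, $\varphi_1(\cdot,t)\in H^1(\Omega)$ for all $t\in[0,T]$, and $\varphi_2\in L^2(I;H^1(\Omega))$, solve $$-\partial_t\varphi_1-u\cdot\nabla\varphi_1-\varphi_2-\nu\Delta\varphi_1=0,\qquad -\Delta\varphi_2-\nabla\omega_h\cdot\operatorname{rot}\varphi_1=0\quad\text{in }Q,\qquad \varphi_1(\cdot,T)=\xi_0\ \text{ in }\Omega,$$ the first equation a.e. in $Q$ and the second in the weak sense for a.e. $t$. **Stability.** There is an absolute constant $C$ such that for all such $\nu,T,u,\omega_h,\xi_0,\varphi_1,\varphi_2$ $$\sup_{t\in I}\|\nabla\varphi_1(\cdot,t)\|+\|\nu^{1/2}D^2\varphi_1\|_{L^2(Q)}\le C\,e^{T/\tau_F}\|\nabla\xi_0\|,$$ $$\int_I\|\nabla\varphi_2(\cdot,t)\|\,dt\le e^{T/\tau_F}\int_I\|\omega_h(\cdot,t)\|_{L^\infty(\Omega)}\,dt\;\|\nabla\xi_0\|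 .$$ **Large eddy assumption.** For every $K>0$ there is $C>0$ depending only on $K$ such that for all $\nu>0$, $T>0$ and $u\in L^\infty(Q)^2$: if $u=\bar u+u'$ with $\bar u\in[L^\infty(I;W^{1,\infty}(\Omega))]^2$, where $\|\bar u\|_{L^\infty(Q)}\le K$ and $\|\partial_j\bar u_i\|_{L^\infty(Q)}\le K$ for all $i,j$, and $\|u'\|_{L^\infty(Q)}^2\le K\nu$, then $\tau_F\ge C^{-1}$. If in addition $\int_\Omega u(x,t)\,dx=0$ for a.e. $t\in I$ (as for $u=\operatorname{rot}\Psi$), the characteristic velocity satisfies $\|u\|_{L^\infty(Q)}\ge K^{-1}$, and $\nu\le K$, then also $\tau_F\le C$; that is, $\tau_F\sim1$. -/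

import Mathlib

open MeasureTheory Set
open scoped ENNReal ContDiff

namespace DualStab

/-- The periodic unit square `Ω = (ℝ/ℤ)²`, with its Lebesgue (Haar probability) measure `volume`. -/
abbrev Torus : Type := UnitAddTorus (Fin 2)

/-- Euclidean plane vectors. -/
abbrev E2 : Type := EuclideanSpace ℝ (Fin 2)

/-- Lebesgue measure on the space-time cylinder `Q = I × Ω`, `I = (0,T)`. -/
noncomputable def slab (T : ℝ) : Measure (ℝ × Torus) :=
  (volume.restrict (Ioo 0 T)).prod volume

/-- Smooth periodic functions: the lift to the plane is `C^∞`. -/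
def IsTest (ψ : Torus → ℝ) : Prop :=
  ContDiff ℝ ∞ (fun y : Fin 2 → ℝ => ψ (fun i => (y i : UnitAddCircle)))

/-- The classical partial derivative `∂_i ψ` of a function on the torus. -/
noncomputable def pd (i : Fin 2) (ψ : Torus → ℝ) (x : Torus) : ℝ :=
  deriv (fun s : ℝ => ψ (x + Pi.single i (s : UnitAddCircle))) 0

/-- `g` is the weak partial derivative `∂_i f` on the torus. -/
def HasWeakPartial (i : Fin 2) (f g : Torus → ℝ) : Prop :=
  Integrable f ∧ Integrable g ∧
    ∀ ψ : Torus → ℝ, IsTest ψ → ∫ x, f x * pd i ψ x = - ∫ x, g x * ψ x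

/-- `g` is the weak gradient of `f` on the torus. -/
def HasWeakGrad (f : Torus → ℝ) (g : Torus → E2) : Prop :=
  ∀ i : Fin 2, HasWeakPartial i f (fun x => g x i)

/-- `rot φ = (∂₂φ, -∂₁φ)`, as a function of `g = ∇φ`. -/
noncomputable def rotOf (g : E2) : E2 := !₂[g 1, - g 0]

/-- `f` is in `L^∞(I; W^{1,∞}(Ω))`, with weak spatial gradient `g`. -/
def MemLinftyW1 (T : ℝ) (f : ℝ → Torus → ℝ) (g : ℝ → Torus → E2) : Prop :=
  MemLp (Function.uncurry f) ⊤ (slab T) ∧ MemLp (Function.uncurry g) ⊤ (slab T) ∧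
    ∀ᵐ t ∂(volume.restrict (Ioo 0 T)), HasWeakGrad (f t) (g t)

/-- The vector field `v` is in `[L^∞(I; W^{1,∞}(Ω))]²`, with weak spatial gradient `D`,
`D i j = ∂_j v_i`. -/
def MemLinftyW1Vec (T : ℝ) (v : ℝ → Torus → E2)
    (D : ℝ → Torus → Matrix (Fin 2) (Fin 2) ℝ) : Prop :=
  ∀ i : Fin 2, MemLinftyW1 T (fun t x => v t x i) (fun t x => WithLp.toLp 2 (D t x i))

/-- The matrix `Λ = ∇_S ū - ½ (∇·ū) I + (1/(2ν)) u' ⊗ u'`, where `D = ∇ū` and `w = u'`. -/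
noncomputable def Lam (ν : ℝ) (D : Matrix (Fin 2) (Fin 2) ℝ) (w : E2) :
    Matrix (Fin 2) (Fin 2) ℝ :=
  (1 / 2 : ℝ) • (D + D.transpose) - (1 / 2 * D.trace) • (1 : Matrix (Fin 2) (Fin 2) ℝ)
    + (1 / (2 * ν)) • Matrix.vecMulVec w.ofLp w.ofLp

/-- The largest positive eigenvalue of a matrix (`0` if there is none). -/
noncomputable def sigmaPlus (A : Matrix (Fin 2) (Fin 2) ℝ) : ℝ :=
  sSup {μ : ℝ | 0 < μ ∧ Module.End.HasEigenvalue (Matrix.toLin' A) μ}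

/-- `τ_F⁻¹`: the infimum, over all large scale fields `ū = v` in `[L^∞(I; W^{1,∞}(Ω))]²`
(with `u' = u - ū`), of `‖σ⁺(Λ(ū, u', ν))‖_{L^∞(Q)}`. -/
noncomputable def flowRate (ν T : ℝ) (u : ℝ → Torus → E2) : ℝ≥0∞ :=
  ⨅ (v : ℝ → Torus → E2) (D : ℝ → Torus → Matrix (Fin 2) (Fin 2) ℝ)
    (_ : MemLinftyW1Vec T v D),
    eLpNorm (fun p : ℝ × Torus => sigmaPlus (Lam ν (D p.1 p.2) (u p.1 p.2 - v p.1 p.2)))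
      ⊤ (slab T)

/-- The flow time scale `τ_F`, in `[0, ∞]`. -/
noncomputable def flowTime (ν T : ℝ) (u : ℝ → Torus → E2) : ℝ≥0∞ := (flowRate ν T u)⁻¹

/-- The factor `e^{T/τ_F}`. -/
noncomputable def growth (ν T : ℝ) (u : ℝ → Torus → E2) : ℝ≥0∞ :=
  EReal.exp ((ENNReal.ofReal T / flowTime ν T u : ℝ≥0∞) : EReal)

/-- `(φ₁, φ₂)` is a (strong) solution of the backward dual problem
`-∂ₜφ₁ - u·∇φ₁ - φ₂ - νΔφ₁ = 0`, `-Δφ₂ - ∇ω_h·rot φ₁ = 0`, `φ₁(T) = ξ₀`.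
Here `gω = ∇ω_h`, and `w, g₁, H₁, g₂` are `∂ₜφ₁, ∇φ₁, D²φ₁, ∇φ₂`:
`φ₁` is in `H¹(I; L²) ∩ L²(I; H²)`, with the representative that is defined for every `t` and is
`H¹(Ω)`-valued, and `φ₂` is in `L²(I; H¹)`. -/
structure IsDualSolution (ν T : ℝ) (u gω : ℝ → Torus → E2) (ξ : Torus → ℝ)
    (φ₁ w : ℝ → Torus → ℝ) (g₁ : ℝ → Torus → E2)
    (H₁ : ℝ → Torus → Matrix (Fin 2) (Fin 2) ℝ)
    (φ₂ : ℝ → Torus → ℝ) (g₂ : ℝ → Torus → E2) : Prop where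
  memLp_phi₁ : MemLp (Function.uncurry φ₁) 2 (slab T)
  memLp_dt : MemLp (Function.uncurry w) 2 (slab T)
  memLp_grad₁ : MemLp (Function.uncurry g₁) 2 (slab T)
  memLp_hess₁ : ∀ i j : Fin 2, MemLp (fun p : ℝ × Torus => H₁ p.1 p.2 i j) 2 (slab T)
  memLp_phi₂ : MemLp (Function.uncurry φ₂) 2 (slab T)
  memLp_grad₂ : MemLp (Function.uncurry g₂) 2 (slab T)
  memLp_slice : ∀ t ∈ Icc 0 T, MemLp (φ₁ t) 2 ∧ MemLp (g₁ t) 2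
  grad₁ : ∀ t ∈ Icc 0 T, HasWeakGrad (φ₁ t) (g₁ t)
  hess₁ : ∀ᵐ t ∂(volume.restrict (Ioo 0 T)), ∀ i : Fin 2,
    HasWeakGrad (fun x => g₁ t x i) (fun x => WithLp.toLp 2 (H₁ t x i))
  dt : ∀ s ∈ Icc 0 T, ∀ t ∈ Icc 0 T, ∀ᵐ x : Torus,
    φ₁ t x - φ₁ s x = ∫ r in s..t, w r x
  grad₂ : ∀ᵐ t ∂(volume.restrict (Ioo 0 T)), HasWeakGrad (φ₂ t) (g₂ t)
  eq₁ : ∀ᵐ p ∂(slab T),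
    - w p.1 p.2 - inner ℝ (u p.1 p.2) (g₁ p.1 p.2) - φ₂ p.1 p.2
      - ν * (H₁ p.1 p.2).trace = 0
  eq₂ : ∀ᵐ t ∂(volume.restrict (Ioo 0 T)), ∀ ψ : Torus → ℝ, IsTest ψ →
    (∫ x, ∑ i : Fin 2, g₂ t x i * pd i ψ x) - ∫ x, inner ℝ (gω t x) (rotOf (g₁ t x)) * ψ x = 0
  terminal : φ₁ T =ᵐ[volume] ξ

/-- The large eddy assumption with constant `K`: `u = ū + u'`, where the `L^∞(Q)` norms of `ū`
and `∇ū` are at most `K` and `‖u'‖²_{L^∞(Q)} ≤ K ν`. -/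
def LargeEddy (K ν T : ℝ) (u : ℝ → Torus → E2) : Prop :=
  ∃ (v : ℝ → Torus → E2) (D : ℝ → Torus → Matrix (Fin 2) (Fin 2) ℝ),
    MemLinftyW1Vec T v D ∧
    eLpNorm (Function.uncurry v) ⊤ (slab T) ≤ ENNReal.ofReal K ∧
    (∀ i j : Fin 2,
      eLpNorm (fun p : ℝ × Torus => D p.1 p.2 i j) ⊤ (slab T) ≤ ENNReal.ofReal K) ∧
    eLpNorm (fun p : ℝ × Torus => u p.1 p.2 - v p.1 p.2) ⊤ (slab T) ^ 2
      ≤ ENNReal.ofReal (K * ν)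

end DualStab

/-!
Stability of the dual of the two-dimensional Navier-Stokes equations in vorticity form, with
constants that depend on the large scales of the flow only.

**Stability.** Testing the equation of `φ₁` with `-Δφ₁` gives an energy identity for `‖∇φ₁‖²`
(`energy_identity`). It is derived one frequency at a time: every Fourier coefficient of `φ₁` is
absolutely continuous in time, and Parseval's identity sums the frequencies. In the right-hand side

* the term with `φ₂` vanishes: up to sign it is `∫ ∇φ₂ · ∇φ₁`, which by the weak equation of `φ₂` equals
  `∫ (∇ω_h · rot φ₁) φ₁`, and `rot φ₁` is divergence free and orthogonal to `∇φ₁`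
  (`elliptic_slice`);
* the transport by the large scales `ū` is integrated by parts, which leaves the quadratic form of
  `∇_S ū - ½ (∇ · ū) I` at `∇φ₁` (`integral_transport_mul_lap`);
* the transport by `u'` is absorbed in half of the dissipation with Young's inequality, which adds
  the quadratic form of `u' ⊗ u' / (2ν)` (`integral_dt_mul_lap_le`).

Together these are the quadratic form of `Λ`, at most `σ⁺(Λ) |∇φ₁|²`. Grönwall's inequality gives
the energy estimate for a fixed `ū`, and the infimum over `ū` is approached at the end
(`IsDualSolution.energy_le_flowRate`). On the torus the Hessian and the Laplacian have the same
`L²` norm. Testing the equation of `φ₂` with `φ₂` itself and moving the derivative from `ω_h` to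
`φ₂` gives `‖∇φ₂‖ ≤ ‖ω_h‖_∞ ‖∇φ₁‖`, hence the second estimate.

**Large eddies.** That `τ_F` is bounded below is read off from the given splitting. For the upper
bound let `σ⁺(Λ) ≤ ε` for some splitting. The trace of `Λ` is `|u'|² / (2ν)`, so `u'` is small,
and as `u' ⊗ u'` is nonnegative, the trace-free part of `∇_S ū` has eigenvalues at most `ε` in
absolute value (`bounds_of_sigmaPlus_Lam_le`). In the plane this
trace-free part is the Cauchy-Riemann operator, whose only periodic null solutions are constants.
Quantitatively, `ū` is uniformly close to its mean (`ae_abs_sub_mean_le`): the radial derivative of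
the circle averages of one component of `ū` involves only the Cauchy-Riemann operator, so the
component is close to its averages over discs, and these are controlled by an `L²` bound that
Fourier series give. As `u` has mean zero, the mean of `ū` is small too, and so is `u`
(`ae_norm_le_of_sigmaPlus_le`). With a lower bound on `‖u‖_∞` this bounds `ε` from below.
-/

namespace DualStab

open Filter Topology UnitAddTorus ComplexConjugate

/-! ### Fourier series on the torus -/

theorem volume_circle_eq_haar :
    (volume : Measure UnitAddCircle) = AddCircle.haarAddCircle := by
  rw [AddCircle.volume_eq_smul_haarAddCircle]; simp

instance : IsProbabilityMeasure (volume : Measure UnitAddCircle) := by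
  rw [volume_circle_eq_haar]; infer_instance

/-- Mathlib's multivariate Fourier series are developed for the product of the normalised Haar
measures; this identifies that measure with the Lebesgue measure of the torus. -/
theorem volume_torus_eq_pi_haar :
    (volume : Measure Torus) = Measure.pi fun _ : Fin 2 => AddCircle.haarAddCircle := by
  rw [← volume_circle_eq_haar]; rfl

theorem hasSum_fourier_inner_of_eq_pi_haar (μ : Measure Torus)
    (hμ : μ = Measure.pi fun _ : Fin 2 => AddCircle.haarAddCircle)
    {f h : Torus → ℂ} (hf : MemLp f 2 μ) (hh : MemLp h 2 μ) :
    HasSum (fun k => conj (∫ x, mFourier (-k) x * f x ∂μ) * (∫ x, mFourier (-k) x * h x ∂μ))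
      (∫ x, conj (f x) * h x ∂μ) := by
  subst hμ
  have key := UnitAddTorus.hasSum_prod_mFourierCoeff (hf.toLp f) (hh.toLp h)
  have e1 : ∀ {f : Torus → ℂ} (hf : MemLp f 2 (Measure.pi fun _ : Fin 2 => AddCircle.haarAddCircle))
      (k : Fin 2 → ℤ), mFourierCoeff (hf.toLp f) k
        = ∫ x, mFourier (-k) x * f x ∂(Measure.pi fun _ : Fin 2 => AddCircle.haarAddCircle) := by
    intro f hf k
    refine integral_congr_ae ?_
    filter_upwards [hf.coeFn_toLp] with x hx
    rw [hx, smul_eq_mul]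
  simp only [e1] at key
  convert key using 1
  refine integral_congr_ae ?_
  filter_upwards [hf.coeFn_toLp, hh.coeFn_toLp] with x hx hx'
  rw [hx, hx']

theorem tendsto_fourier_partialSum_of_eq_pi_haar (μ : Measure Torus)
    (hμ : μ = Measure.pi fun _ : Fin 2 => AddCircle.haarAddCircle)
    {f : Torus → ℂ} (hf : MemLp f 2 μ) :
    Tendsto (fun s : Finset (Fin 2 → ℤ) => eLpNorm (fun x =>
      (∑ k ∈ s, (∫ y, mFourier (-k) y * f y ∂μ) * mFourier k x) - f x) 2 μ) atTop (𝓝 0) := by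
  subst hμ
  have key := UnitAddTorus.hasSum_mFourier_series_L2 (hf.toLp f)
  have e1 : ∀ (k : Fin 2 → ℤ), mFourierCoeff (hf.toLp f) k
        = ∫ x, mFourier (-k) x * f x ∂(Measure.pi fun _ : Fin 2 => AddCircle.haarAddCircle) := by
    intro k
    refine integral_congr_ae ?_
    filter_upwards [hf.coeFn_toLp] with x hx
    rw [hx, smul_eq_mul]
  simp only [e1] at key
  rw [HasSum, SummationFilter.unconditional_filter, tendsto_iff_edist_tendsto_0] at key
  refine key.congr fun s => ?_
  rw [Lp.edist_def]
  refine eLpNorm_congr_ae ?_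
  have h1 : ∀ s : Finset (Fin 2 → ℤ), ∀ a : (Fin 2 → ℤ) → ℂ,
      (⇑(∑ k ∈ s, a k • mFourierLp (d := Fin 2) 2 k) : Torus → ℂ)
      =ᵐ[Measure.pi fun _ : Fin 2 => AddCircle.haarAddCircle] fun x => ∑ k ∈ s, a k * mFourier k x := by
    intro s a
    classical
    induction s using Finset.induction_on with
    | empty =>
      simp only [Finset.sum_empty]
      exact Lp.coeFn_zero _ _ _
    | insert k s hk ih =>
      simp only [Finset.sum_insert hk]
      filter_upwards [ih, Lp.coeFn_add (a k • mFourierLp (d := Fin 2) 2 k)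
        (∑ k ∈ s, a k • mFourierLp (d := Fin 2) 2 k), Lp.coeFn_smul (a k) (mFourierLp (d := Fin 2) 2 k),
        coeFn_mFourierLp (d := Fin 2) 2 k] with x h1 h2 h3 h4
      rw [h2, Pi.add_apply, h1, h3, Pi.smul_apply, h4, smul_eq_mul]
  filter_upwards [h1 s _, hf.coeFn_toLp] with x hx hx'
  rw [Pi.sub_apply, hx, hx']

/-- The Fourier coefficient of a real function on the torus. -/
noncomputable def coef (f : Torus → ℝ) (k : Fin 2 → ℤ) : ℂ := ∫ x, mFourier (-k) x * (f x : ℂ)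

/-- The real part of the trigonometric polynomial with coefficients `a` and frequencies in `s`. -/
noncomputable def trig (s : Finset (Fin 2 → ℤ)) (a : (Fin 2 → ℤ) → ℂ) (x : Torus) : ℝ :=
  (∑ k ∈ s, a k * mFourier k x).re

/-- The partial sum of the Fourier series over the frequencies in `s`. -/
noncomputable def trunc (s : Finset (Fin 2 → ℤ)) (f : Torus → ℝ) : Torus → ℝ := trig s (coef f)

/-- The Fourier symbol `2πi kᵢ` of `∂ᵢ`. -/
noncomputable def symb (i : Fin 2) (k : Fin 2 → ℤ) : ℂ := 2 * Real.pi * Complex.I * k i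

/-- **Parseval's identity** for real functions. -/
theorem hasSum_coef_inner {f h : Torus → ℝ} (hf : MemLp f 2) (hh : MemLp h 2) :
    HasSum (fun k => (conj (coef f k) * coef h k).re) (∫ x, f x * h x) := by
  have key := Complex.hasSum_re (hasSum_fourier_inner_of_eq_pi_haar volume volume_torus_eq_pi_haar
    (f := fun x => (f x : ℂ)) (h := fun x => (h x : ℂ)) hf.ofReal hh.ofReal)
  have e : (fun x => conj ((f x : ℂ)) * (h x : ℂ)) = fun x => ((f x * h x : ℝ) : ℂ) := by
    ext x; simp
  rw [e, integral_complex_ofReal, Complex.ofReal_re] at key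
  exact key

theorem hasSum_coef_sq {f : Torus → ℝ} (hf : MemLp f 2) :
    HasSum (fun k => ‖coef f k‖ ^ 2) (∫ x, f x ^ 2) := by
  have := hasSum_coef_inner hf hf
  simp only [← sq] at this
  convert this using 2 with k
  rw [← Complex.normSq_eq_conj_mul_self, Complex.ofReal_re, Complex.normSq_eq_norm_sq]

theorem continuous_trig (s a) : Continuous (trig s a) := by
  unfold trig; fun_prop

theorem memLp_trig (s a) (p : ℝ≥0∞) : MemLp (trig s a) p :=
  (BoundedContinuousFunction.mkOfCompact ⟨_, continuous_trig s a⟩).memLp_top.mono_exponent le_top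

theorem tendsto_trunc {f : Torus → ℝ} (hf : MemLp f 2) :
    Tendsto (fun s => eLpNorm (fun x => trunc s f x - f x) 2 volume) atTop (𝓝 0) := by
  refine tendsto_of_tendsto_of_tendsto_of_le_of_le tendsto_const_nhds
    (tendsto_fourier_partialSum_of_eq_pi_haar volume volume_torus_eq_pi_haar hf.ofReal)
    (fun s => zero_le) fun s => ?_
  refine eLpNorm_mono fun x => ?_
  have : trunc s f x - f x = ((∑ k ∈ s, coef f k * mFourier k x) - (f x : ℂ)).re := by
    simp [trunc, trig]
  rw [this]
  exact Complex.abs_re_le_norm _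

theorem ae_eq_of_coef_eq {f h : Torus → ℝ} (hf : MemLp f 2) (hh : MemLp h 2)
    (hfh : ∀ k, coef f k = coef h k) : f =ᵐ[volume] h := by
  have e : ∀ k, coef (fun x => f x - h x) k = 0 := by
    intro k
    have : coef (fun x => f x - h x) k = coef f k - coef h k := by
      unfold coef
      rw [← integral_sub]
      · congr 1; ext x; push_cast; ring
      all_goals
        refine Integrable.bdd_mul (c := 1) ?_ (by fun_prop) (.of_forall fun x => ?_)
        · exact (MemLp.integrable one_le_two (by assumption)).ofReal
        · exact ((mFourier (-k)).norm_coe_le_norm x).trans mFourier_norm.le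
    rw [this, hfh, sub_self]
  have h2 := hasSum_coef_sq (hf.sub hh)
  have h3 : ∫ x, (f x - h x) ^ 2 = 0 := by
    refine h2.unique ?_
    have : (fun k => ‖coef (f - h) k‖ ^ 2) = fun k => 0 := by
      ext k; rw [show f - h = fun x => f x - h x from rfl, e k]; simp
    rw [this]; exact hasSum_zero
  have h4 := (integral_eq_zero_iff_of_nonneg (fun x => sq_nonneg (f x - h x))
    (show Integrable (fun x => (f x - h x) ^ 2) from (hf.sub hh).integrable_sq)).1 h3
  filter_upwards [h4] with x hx
  simp only [Pi.zero_apply, sq_eq_zero_iff] at hx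
  linarith

theorem mFourier_lift (k : Fin 2 → ℤ) (y : Fin 2 → ℝ) :
    mFourier k (fun i => (y i : UnitAddCircle)) =
      Complex.exp (2 * Real.pi * Complex.I * ∑ i, (k i : ℂ) * y i) := by
  simp only [mFourier, ContinuousMap.coe_mk, fourier_coe_apply, ← Complex.exp_sum]
  congr 1
  rw [Finset.mul_sum]
  refine Finset.sum_congr rfl fun i _ => ?_
  push_cast; ring

theorem isTest_trig (s a) : IsTest (trig s a) := by
  unfold IsTest trig
  simp only [mFourier_lift]
  refine Complex.reCLM.contDiff.comp (ContDiff.sum fun k _ => contDiff_const.mul ?_)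
  refine ContDiff.cexp (contDiff_const.mul (ContDiff.sum fun i _ => contDiff_const.mul ?_))
  exact Complex.ofRealCLM.contDiff.comp (contDiff_apply ℝ ℝ i)

theorem exists_lift (x : Torus) : ∃ y : Fin 2 → ℝ, (fun i => (y i : UnitAddCircle)) = x := by
  choose y hy using fun i => QuotientAddGroup.mk_surjective (x i)
  exact ⟨y, funext hy⟩

theorem lift_add_single (y : Fin 2 → ℝ) (i : Fin 2) (s : ℝ) :
    (fun j => (y j : UnitAddCircle)) + Pi.single i (s : UnitAddCircle)
      = fun j => (((y + s • (Pi.single i 1 : Fin 2 → ℝ)) j : ℝ) : UnitAddCircle) := by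
  ext j
  by_cases h : j = i
  · subst h; simp
  · simp [h]

theorem IsTest.hasDerivAt {ψ : Torus → ℝ} (hψ : IsTest ψ) (i : Fin 2) (x : Torus) :
    HasDerivAt (fun s : ℝ => ψ (x + Pi.single i (s : UnitAddCircle))) (pd i ψ x) 0 := by
  refine DifferentiableAt.hasDerivAt ?_
  obtain ⟨y, rfl⟩ := exists_lift x
  simp only [lift_add_single]
  have h1 : Differentiable ℝ (fun y : Fin 2 → ℝ => ψ (fun i => (y i : UnitAddCircle))) :=
    hψ.differentiable (by simp)
  exact (h1.comp (f := fun s : ℝ => y + s • (Pi.single i 1 : Fin 2 → ℝ)) (by fun_prop)) 0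

theorem IsTest.mul {ψ χ : Torus → ℝ} (hψ : IsTest ψ) (hχ : IsTest χ) :
    IsTest (fun x => ψ x * χ x) := ContDiff.mul hψ hχ

theorem pd_mul {ψ χ : Torus → ℝ} (hψ : IsTest ψ) (hχ : IsTest χ) (i : Fin 2) (x : Torus) :
    pd i (fun x => ψ x * χ x) x = pd i ψ x * χ x + ψ x * pd i χ x := by
  have := ((hψ.hasDerivAt i x).fun_mul (hχ.hasDerivAt i x)).deriv
  simpa [pd] using this

theorem hasDerivAt_mFourier (k : Fin 2 → ℤ) (i : Fin 2) (x : Torus) :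
    HasDerivAt (fun s : ℝ => mFourier k (x + Pi.single i (s : UnitAddCircle)))
      (symb i k * mFourier k x) 0 := by
  obtain ⟨y, rfl⟩ := exists_lift x
  simp only [lift_add_single, mFourier_lift]
  have h : HasDerivAt (fun s : ℝ => 2 * Real.pi * Complex.I *
      ∑ j, (k j : ℂ) * (((y + s • (Pi.single i 1 : Fin 2 → ℝ)) j : ℝ) : ℂ)) (symb i k) 0 := by
    have h0 : ∀ j, HasDerivAt (fun s : ℝ => (((y + s • (Pi.single i 1 : Fin 2 → ℝ)) j : ℝ) : ℂ))
        (((Pi.single i (1 : ℝ) : Fin 2 → ℝ) j : ℝ) : ℂ) 0 := by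
      intro j
      refine HasDerivAt.ofReal_comp (f := fun s : ℝ => (y + s • (Pi.single i 1 : Fin 2 → ℝ)) j) ?_
      simpa using ((hasDerivAt_id (0 : ℝ)).mul_const ((Pi.single i (1 : ℝ) : Fin 2 → ℝ) j)).const_add (y j)
    have := (HasDerivAt.fun_sum (u := Finset.univ) fun j _ => (h0 j).const_mul (k j : ℂ)).const_mul
      (2 * Real.pi * Complex.I : ℂ)
    refine this.congr_deriv ?_
    unfold symb
    congr 1
    fin_cases i <;> simp
  refine h.cexp.congr_deriv ?_
  simp [mul_comm]

theorem pd_trig (i : Fin 2) (s a) (x : Torus) :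
    pd i (trig s a) x = trig s (fun k => symb i k * a k) x := by
  refine HasDerivAt.deriv ?_
  have h := HasDerivAt.fun_sum (u := s) fun k _ => (hasDerivAt_mFourier k i x).const_mul (a k)
  have := (Complex.reCLM.hasFDerivAt.comp_hasDerivAt (0 : ℝ) h)
  refine this.congr_deriv ?_
  simp only [trig, Complex.reCLM_apply]
  congr 1
  exact Finset.sum_congr rfl fun k _ => by ring

theorem integrable_mFourier_mul {f : Torus → ℝ} (hf : Integrable f) (k : Fin 2 → ℤ) :
    Integrable fun x => mFourier k x * (f x : ℂ) :=
  Integrable.bdd_mul (c := 1) hf.ofReal (by fun_prop)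
    (.of_forall fun x => ((mFourier k).norm_coe_le_norm x).trans mFourier_norm.le)

theorem integral_mul_trig {f : Torus → ℝ} (hf : Integrable f) (k : Fin 2 → ℤ) (a) :
    ∫ x, f x * trig {-k} a x = (a (-k) * coef f k).re := by
  have h : ∀ x, f x * trig {-k} a x = (a (-k) * (mFourier (-k) x * (f x : ℂ))).re := by
    intro x
    simp only [trig, Finset.sum_singleton, ← mul_assoc]
    rw [Complex.re_mul_ofReal, mul_comm]
  simp only [h]
  rw [coef, ← integral_const_mul]
  exact integral_re ((integrable_mFourier_mul hf (-k)).const_mul (a (-k)))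

theorem HasWeakPartial.coef_eq {i : Fin 2} {f g : Torus → ℝ} (h : HasWeakPartial i f g)
    (k : Fin 2 → ℤ) : coef g k = symb i k * coef f k := by
  have key : ∀ a : ℂ, (a * coef g k).re = (a * (symb i k * coef f k)).re := by
    intro a
    have := h.2.2 _ (isTest_trig {-k} fun _ => a)
    rw [integral_mul_trig h.2.1] at this
    simp only [pd_trig] at this
    rw [integral_mul_trig h.1] at this
    have e : symb i (-k) = - symb i k := by simp [symb]
    rw [e] at this
    simp only [neg_mul, Complex.neg_re] at this
    rw [neg_inj] at this
    rw [← this]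
    congr 1; ring
  refine Complex.ext (by simpa using key 1) ?_
  have := key (-Complex.I)
  simpa using this

theorem HasWeakPartial.pd_trunc {i : Fin 2} {f g : Torus → ℝ} (h : HasWeakPartial i f g)
    (s : Finset (Fin 2 → ℤ)) (x : Torus) : pd i (trunc s f) x = trunc s g x := by
  rw [trunc, pd_trig, trunc]
  congr 1
  ext k
  rw [h.coef_eq]

/-! ### Integration by parts for weak derivatives -/

theorem conj_symb (i : Fin 2) (k : Fin 2 → ℤ) : conj (symb i k) = - symb i k := by
  have h2 : conj (2 : ℂ) = 2 := Complex.conj_ofNat 2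
  simp [symb, Complex.conj_ofReal, h2]

/-- Both factors are only weakly differentiable here, and the identity is Parseval's. -/
theorem HasWeakPartial.integral_mul_eq_neg {i : Fin 2} {f fi h hi : Torus → ℝ}
    (hf : HasWeakPartial i f fi) (hh : HasWeakPartial i h hi)
    (mf : MemLp f 2) (mfi : MemLp fi 2) (mh : MemLp h 2) (mhi : MemLp hi 2) :
    ∫ x, f x * hi x = - ∫ x, fi x * h x := by
  refine (hasSum_coef_inner mf mhi).unique ?_
  refine (hasSum_coef_inner mfi mh).neg.congr_fun fun k => ?_
  rw [hf.coef_eq, hh.coef_eq, map_mul, conj_symb, ← Complex.neg_re]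
  congr 1; ring

theorem HasWeakPartial.ae_unique {i : Fin 2} {f f' g g' : Torus → ℝ}
    (h : HasWeakPartial i f g) (h' : HasWeakPartial i f' g') (hff' : f =ᵐ[volume] f')
    (mg : MemLp g 2) (mg' : MemLp g' 2) : g =ᵐ[volume] g' := by
  refine ae_eq_of_coef_eq mg mg' fun k => ?_
  rw [h.coef_eq, h'.coef_eq]
  congr 1
  refine integral_congr_ae ?_
  filter_upwards [hff'] with x hx
  rw [hx]

/-- Weak second derivatives commute, as their Fourier symbols do. -/
theorem HasWeakPartial.ae_symm {i j : Fin 2} {f fi fj fij fji : Torus → ℝ}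
    (hi : HasWeakPartial i f fi) (hj : HasWeakPartial j f fj)
    (hij : HasWeakPartial j fi fij) (hji : HasWeakPartial i fj fji)
    (mij : MemLp fij 2) (mji : MemLp fji 2) : fij =ᵐ[volume] fji := by
  refine ae_eq_of_coef_eq mij mji fun k => ?_
  rw [hij.coef_eq, hji.coef_eq, hi.coef_eq, hj.coef_eq]
  ring

/-- On the torus the Hessian and the Laplacian have the same `L²` norm. -/
theorem integral_hess_sq_eq_integral_lap_sq {f : Torus → ℝ} {g : Fin 2 → Torus → ℝ}
    {H : Fin 2 → Fin 2 → Torus → ℝ} (hf : ∀ i, HasWeakPartial i f (g i))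
    (hg : ∀ i j, HasWeakPartial j (g i) (H i j)) (mH : ∀ i j, MemLp (H i j) 2) :
    ∫ x, ∑ i : Fin 2, ∑ j : Fin 2, H i j x ^ 2 = ∫ x, (H 0 0 x + H 1 1 x) ^ 2 := by
  have hs : ∀ i j, Integrable fun x => H i j x ^ 2 := fun i j => (mH i j).integrable_sq
  have hm : Integrable fun x => 2 * (H 0 0 x * H 1 1 x) :=
    ((mH 0 0).integrable_mul (mH 1 1)).const_mul 2
  have h1 : ∫ x, H 0 1 x ^ 2 = ∫ x, H 0 0 x * H 1 1 x := by
    refine (hasSum_coef_sq (mH 0 1)).unique ((hasSum_coef_inner (mH 0 0) (mH 1 1)).congr_fun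
      fun k => ?_)
    have e : ∀ i j : Fin 2, coef (H i j) k = symb j k * (symb i k * coef f k) := by
      intro i j
      rw [(hg i j).coef_eq, (hf i).coef_eq]
    rw [← Complex.ofReal_re (_ ^ 2), ← Complex.normSq_eq_norm_sq, Complex.normSq_eq_conj_mul_self,
      e, e, e]
    simp only [map_mul, conj_symb]
    congr 1; ring
  have h2 : ∫ x, H 1 0 x ^ 2 = ∫ x, H 0 1 x ^ 2 := by
    refine integral_congr_ae ?_
    filter_upwards [(hf 1).ae_symm (hf 0) (hg 1 0) (hg 0 1) (mH 1 0) (mH 0 1)] with x hx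
    rw [hx]
  have h3 : ∫ x, (H 0 0 x + H 1 1 x) ^ 2
      = (∫ x, H 0 0 x ^ 2) + (∫ x, H 1 1 x ^ 2) + 2 * ∫ x, H 0 0 x * H 1 1 x := by
    rw [← integral_const_mul, ← integral_add (hs 0 0) (hs 1 1),
      ← integral_add (Integrable.fun_add (hs 0 0) (hs 1 1)) hm]
    congr 1; ext x; ring
  rw [h3, ← h1]
  simp only [Fin.sum_univ_two]
  rw [integral_add (Integrable.fun_add (hs 0 0) (hs 0 1)) (Integrable.fun_add (hs 1 0) (hs 1 1)),
    integral_add (hs 0 0) (hs 0 1), integral_add (hs 1 0) (hs 1 1), h2]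
  ring

theorem ae_norm_le_toReal_eLpNorm_top {α E : Type*} [MeasurableSpace α] {μ : Measure α}
    [NormedAddCommGroup E] {b : α → E} (mb : MemLp b ⊤ μ) :
    ∀ᵐ x ∂μ, ‖b x‖ ≤ (eLpNorm b ⊤ μ).toReal := by
  have h := ae_le_eLpNormEssSup (f := b) (μ := μ)
  filter_upwards [h] with x hx
  rw [← eLpNorm_exponent_top] at hx
  rw [← toReal_enorm]
  exact ENNReal.toReal_mono mb.2.ne hx

theorem integrable_bdd_mul_mul {b p q : Torus → ℝ} (mb : MemLp b ⊤) (mp : MemLp p 2)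
    (mq : MemLp q 2) : Integrable fun x => b x * (p x * q x) :=
  Integrable.bdd_mul (mp.integrable_mul mq) mb.1 (ae_norm_le_toReal_eLpNorm_top mb)

theorem eLpNorm_bdd_mul_mul_le {b p q : Torus → ℝ} (mb : MemLp b ⊤) (mp : MemLp p 2)
    (mq : MemLp q 2) : eLpNorm (fun x => b x * (p x * q x)) 1 volume
      ≤ eLpNorm b ⊤ volume * (eLpNorm p 2 volume * eLpNorm q 2 volume) := by
  refine (eLpNorm_smul_le_mul_eLpNorm (p := ⊤) (q := 1) (r := 1) (f := fun x => p x * q x)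
    (φ := b) (mp.1.mul mq.1) mb.1).trans ?_
  gcongr
  exact eLpNorm_smul_le_mul_eLpNorm (p := 2) (q := 2) (r := 1) (f := q) (φ := p) mq.1 mp.1

theorem tendsto_integral_bdd_mul_mul {ι : Type*} {l : Filter ι} {b p q : Torus → ℝ}
    {P Q : ι → Torus → ℝ} (mb : MemLp b ⊤) (mp : MemLp p 2) (mq : MemLp q 2)
    (mP : ∀ s, MemLp (P s) 2) (mQ : ∀ s, MemLp (Q s) 2)
    (hP : Tendsto (fun s => eLpNorm (fun x => P s x - p x) 2 volume) l (𝓝 0))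
    (hQ : Tendsto (fun s => eLpNorm (fun x => Q s x - q x) 2 volume) l (𝓝 0)) :
    Tendsto (fun s => ∫ x, b x * (P s x * Q s x)) l (𝓝 (∫ x, b x * (p x * q x))) := by
  refine tendsto_integral_of_L1' _ (integrable_bdd_mul_mul mb mp mq).1
    (.of_forall fun s => integrable_bdd_mul_mul mb (mP s) (mQ s)) ?_
  set B := eLpNorm b ⊤ volume
  set dP := fun s => eLpNorm (fun x => P s x - p x) 2 volume
  set dQ := fun s => eLpNorm (fun x => Q s x - q x) 2 volume
  have hlim : Tendsto (fun s => B * (dP s * dQ s) + B * (dP s * eLpNorm q 2 volume)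
      + B * (eLpNorm p 2 volume * dQ s)) l (𝓝 0) := by
    have h1 : Tendsto (fun s => dP s * dQ s) l (𝓝 0) := by
      simpa using ENNReal.Tendsto.mul hP (by simp) hQ (by simp)
    have h2 : Tendsto (fun s => dP s * eLpNorm q 2 volume) l (𝓝 0) := by
      simpa using ENNReal.Tendsto.mul_const hP (.inr mq.2.ne)
    have h3 : Tendsto (fun s => eLpNorm p 2 volume * dQ s) l (𝓝 0) := by
      simpa using ENNReal.Tendsto.const_mul hQ (.inr mp.2.ne)
    have hB : B ≠ ⊤ := mb.2.ne
    simpa using ((ENNReal.Tendsto.const_mul h1 (.inr hB)).add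
      (ENNReal.Tendsto.const_mul h2 (.inr hB))).add (ENNReal.Tendsto.const_mul h3 (.inr hB))
  refine tendsto_of_tendsto_of_tendsto_of_le_of_le tendsto_const_nhds hlim (fun s => zero_le)
    fun s => ?_
  have mdP : MemLp (fun x => P s x - p x) 2 := (mP s).sub mp
  have mdQ : MemLp (fun x => Q s x - q x) 2 := (mQ s).sub mq
  have e : (fun x => b x * (P s x * Q s x)) - (fun x => b x * (p x * q x))
      = ((fun x => b x * ((P s x - p x) * (Q s x - q x))) + fun x => b x * ((P s x - p x) * q x))
        + fun x => b x * (p x * (Q s x - q x)) := by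
    ext x; simp only [Pi.add_apply, Pi.sub_apply]; ring
  have i1 := (integrable_bdd_mul_mul mb mdP mdQ).1
  have i2 := (integrable_bdd_mul_mul mb mdP mq).1
  have i3 := (integrable_bdd_mul_mul mb mp mdQ).1
  show eLpNorm _ 1 volume ≤ _
  rw [e]
  refine (eLpNorm_add_le (i1.add i2) i3 le_rfl).trans (add_le_add
    ((eLpNorm_add_le i1 i2 le_rfl).trans (add_le_add ?_ ?_)) ?_)
  · exact eLpNorm_bdd_mul_mul_le mb mdP mdQ
  · exact eLpNorm_bdd_mul_mul_le mb mdP mq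
  · exact eLpNorm_bdd_mul_mul_le mb mp mdQ

/-- The weak product rule `∫ b ∂ᵢ(p q) = -∫ (∂ᵢ b) p q` for `b ∈ W^{1,∞}` and `p, q ∈ H¹`. -/
theorem HasWeakPartial.integral_bdd_mul_mul {i : Fin 2} {b bi p pi q qi : Torus → ℝ}
    (hb : HasWeakPartial i b bi) (hp : HasWeakPartial i p pi) (hq : HasWeakPartial i q qi)
    (mb : MemLp b ⊤) (mbi : MemLp bi ⊤) (mp : MemLp p 2) (mpi : MemLp pi 2)
    (mq : MemLp q 2) (mqi : MemLp qi 2) :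
    (∫ x, b x * (pi x * q x)) + (∫ x, b x * (p x * qi x)) = - ∫ x, bi x * (p x * q x) := by
  have mt : ∀ f s, MemLp (trunc s f) 2 := fun f s => memLp_trig _ _ _
  have key : ∀ s, (∫ x, b x * (trunc s pi x * trunc s q x))
      + (∫ x, b x * (trunc s p x * trunc s qi x)) = - ∫ x, bi x * (trunc s p x * trunc s q x) := by
    intro s
    rw [← integral_add (integrable_bdd_mul_mul mb (mt _ _) (mt _ _))
      (integrable_bdd_mul_mul mb (mt _ _) (mt _ _)),
      ← hb.2.2 (fun x => trunc s p x * trunc s q x)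
        ((isTest_trig s (coef p)).mul (isTest_trig s (coef q)))]
    congr 1; ext x
    rw [pd_mul (ψ := trunc s p) (χ := trunc s q) (isTest_trig s (coef p))
      (isTest_trig s (coef q)), show pd i (fun x => trunc s p x) x = trunc s pi x from hp.pd_trunc s x,
      hq.pd_trunc s x]
    ring
  have l1 := tendsto_integral_bdd_mul_mul mb mpi mq (mt _) (mt _) (tendsto_trunc mpi)
    (tendsto_trunc mq)
  have l2 := tendsto_integral_bdd_mul_mul mb mp mqi (mt _) (mt _) (tendsto_trunc mp)
    (tendsto_trunc mqi)
  have l3 := tendsto_integral_bdd_mul_mul mbi mp mq (mt _) (mt _) (tendsto_trunc mp)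
    (tendsto_trunc mq)
  refine tendsto_nhds_unique (l1.add l2) ?_
  simp only [key]
  exact l3.neg

/-! ### Identities at a fixed time -/

/-- Weak equations that hold against smooth test functions hold against `H¹` functions. -/
theorem integral_mul_eq_of_forall_isTest {G F : Fin 2 → Torus → ℝ} {q f : Torus → ℝ}
    (hG : ∀ ψ, IsTest ψ → ∫ x, ∑ i : Fin 2, G i x * pd i ψ x = ∫ x, q x * ψ x)
    (hf : ∀ i, HasWeakPartial i f (F i)) (mG : ∀ i, MemLp (G i) 2) (mq : MemLp q 2)
    (mf : MemLp f 2) (mF : ∀ i, MemLp (F i) 2) :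
    ∫ x, ∑ i : Fin 2, G i x * F i x = ∫ x, q x * f x := by
  have mt : ∀ f s, MemLp (trunc s f) 2 := fun f s => memLp_trig _ _ _
  have lim : ∀ {p h : Torus → ℝ}, MemLp p 2 → MemLp h 2 →
      Tendsto (fun s => ∫ x, p x * trunc s h x) atTop (𝓝 (∫ x, p x * h x)) := by
    intro p h mp mh
    have := tendsto_integral_bdd_mul_mul (l := atTop) (b := fun _ => 1) (P := fun _ => p)
      (Q := fun s => trunc s h) (memLp_const 1) mp mh (fun _ => mp) (mt h) (by simp)
      (tendsto_trunc mh)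
    simpa using this
  refine tendsto_nhds_unique ?_ (lim mq mf)
  have l2 := tendsto_finsetSum (Finset.univ : Finset (Fin 2)) fun i _ => lim (mG i) (mF i)
  have iGF : ∀ i : Fin 2, ∀ h, MemLp h 2 → Integrable fun x => G i x * h x :=
    fun i h mh => (mG i).integrable_mul mh
  rw [← integral_finsetSum _ fun i _ => iGF i _ (mF i)] at l2
  refine l2.congr fun s => ?_
  rw [← integral_finsetSum _ fun i _ => iGF i _ (mt _ _), show trunc s f = trig s (coef f) from rfl,
    ← hG _ (isTest_trig s _)]
  congr 1; ext x
  exact Finset.sum_congr rfl fun i _ => by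
    rw [show pd i (trig s (coef f)) x = trunc s (F i) x from (hf i).pd_trunc s x]

/-- Since `rot ∇f` is divergence free, `∫ (∇θ · rot f) h = -∫ θ (rot f · ∇h)`. -/
theorem integral_grad_rot_mul {θ f h : Torus → ℝ} {W g k : Fin 2 → Torus → ℝ}
    {H : Fin 2 → Fin 2 → Torus → ℝ}
    (hθ : ∀ i, HasWeakPartial i θ (W i)) (hf : ∀ i, HasWeakPartial i f (g i))
    (hg : ∀ i j, HasWeakPartial j (g i) (H i j)) (hh : ∀ i, HasWeakPartial i h (k i))
    (mθ : MemLp θ ⊤) (mW : ∀ i, MemLp (W i) ⊤) (mg : ∀ i, MemLp (g i) 2)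
    (mH : ∀ i j, MemLp (H i j) 2) (mh : MemLp h 2) (mk : ∀ i, MemLp (k i) 2) :
    ∫ x, (W 0 x * g 1 x - W 1 x * g 0 x) * h x
      = - ∫ x, θ x * (g 1 x * k 0 x - g 0 x * k 1 x) := by
  have h0 := (hθ 0).integral_bdd_mul_mul (hg 1 0) (hh 0) mθ (mW 0) (mg 1) (mH 1 0) mh (mk 0)
  have h1 := (hθ 1).integral_bdd_mul_mul (hg 0 1) (hh 1) mθ (mW 1) (mg 0) (mH 0 1) mh (mk 1)
  have hsymm : ∫ x, θ x * (H 1 0 x * h x) = ∫ x, θ x * (H 0 1 x * h x) := by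
    refine integral_congr_ae ?_
    filter_upwards [(hf 1).ae_symm (hf 0) (hg 1 0) (hg 0 1) (mH 1 0) (mH 0 1)] with x hx
    rw [hx]
  have e1 : ∫ x, (W 0 x * g 1 x - W 1 x * g 0 x) * h x
      = (∫ x, W 0 x * (g 1 x * h x)) - ∫ x, W 1 x * (g 0 x * h x) := by
    rw [← integral_sub (integrable_bdd_mul_mul (mW 0) (mg 1) mh)
      (integrable_bdd_mul_mul (mW 1) (mg 0) mh)]
    congr 1; ext x; ring
  have e2 : ∫ x, θ x * (g 1 x * k 0 x - g 0 x * k 1 x)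
      = (∫ x, θ x * (g 1 x * k 0 x)) - ∫ x, θ x * (g 0 x * k 1 x) := by
    rw [← integral_sub (integrable_bdd_mul_mul mθ (mg 1) (mk 0))
      (integrable_bdd_mul_mul mθ (mg 0) (mk 1))]
    congr 1; ext x; ring
  rw [e1, e2]
  linarith

theorem abs_integral_mul_le {p q : Torus → ℝ} (mp : MemLp p 2) (mq : MemLp q 2) :
    |∫ x, p x * q x| ≤ Real.sqrt (∫ x, p x ^ 2) * Real.sqrt (∫ x, q x ^ 2) := by
  have h := integral_mul_le_Lp_mul_Lq_of_nonneg (μ := (volume : Measure Torus))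
    (p := 2) (q := 2) (f := fun x => |p x|) (g := fun x => |q x|) (by norm_num [Real.holderConjugate_iff])
    (.of_forall fun _ => abs_nonneg _) (.of_forall fun _ => abs_nonneg _)
    (by simpa using mp.norm) (by simpa using mq.norm)
  simp only [Real.rpow_ofNat, sq_abs, ← Real.sqrt_eq_rpow] at h
  refine le_trans ?_ h
  refine (abs_integral_le_integral_abs).trans (le_of_eq ?_)
  simp only [abs_mul]

theorem memLp_sqrt_sq_add_sq {p q : Torus → ℝ} (mp : MemLp p 2) (mq : MemLp q 2) :
    MemLp (fun x => Real.sqrt (p x ^ 2 + q x ^ 2)) 2 := by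
  refine MemLp.of_le (mp.norm.add mq.norm)
    ((mp.1.pow 2).add (mq.1.pow 2)).aemeasurable.sqrt.aestronglyMeasurable (.of_forall fun x => ?_)
  simp only [Pi.add_apply, Real.norm_eq_abs]
  rw [abs_of_nonneg (Real.sqrt_nonneg _), abs_of_nonneg (by positivity)]
  refine Real.sqrt_le_iff.2 ⟨by positivity, ?_⟩
  nlinarith [sq_abs (p x), sq_abs (q x), mul_nonneg (abs_nonneg (p x)) (abs_nonneg (q x))]

/-- The elliptic estimate `‖∇φ₂‖ ≤ ‖θ‖_∞ ‖∇φ₁‖` and the orthogonality `∫ ∇φ₂ · ∇φ₁ = 0`, both from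
testing the equation of `φ₂`. -/
theorem elliptic_slice {θ f h : Torus → ℝ} {W g k : Fin 2 → Torus → ℝ}
    {H : Fin 2 → Fin 2 → Torus → ℝ} {M : ℝ}
    (hθ : ∀ i, HasWeakPartial i θ (W i)) (hf : ∀ i, HasWeakPartial i f (g i))
    (hg : ∀ i j, HasWeakPartial j (g i) (H i j)) (hh : ∀ i, HasWeakPartial i h (k i))
    (mθ : MemLp θ ⊤) (mW : ∀ i, MemLp (W i) ⊤) (mf : MemLp f 2) (mg : ∀ i, MemLp (g i) 2)
    (mH : ∀ i j, MemLp (H i j) 2) (mh : MemLp h 2) (mk : ∀ i, MemLp (k i) 2)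
    (hM : ∀ᵐ x, |θ x| ≤ M)
    (heq : ∀ ψ, IsTest ψ → ∫ x, ∑ i : Fin 2, k i x * pd i ψ x
      = ∫ x, (W 0 x * g 1 x - W 1 x * g 0 x) * ψ x) :
    (∫ x, (k 0 x * g 0 x + k 1 x * g 1 x) = 0) ∧
      Real.sqrt (∫ x, (k 0 x ^ 2 + k 1 x ^ 2)) ≤ M * Real.sqrt (∫ x, (g 0 x ^ 2 + g 1 x ^ 2)) := by
  have mq : MemLp (fun x => W 0 x * g 1 x - W 1 x * g 0 x) 2 :=
    ((mg 1).mul (mW 0)).sub ((mg 0).mul (mW 1))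
  constructor
  · have h1 := integral_mul_eq_of_forall_isTest heq hf mk mq mf mg
    rw [integral_grad_rot_mul hθ hf hg hf mθ mW mg mH mf mg] at h1
    simp only [Fin.sum_univ_two] at h1
    rw [h1]
    simp [mul_comm]
  · have h1 := integral_mul_eq_of_forall_isTest heq hh mk mq mh mk
    rw [integral_grad_rot_mul hθ hf hg hh mθ mW mg mH mh mk] at h1
    simp only [Fin.sum_univ_two, ← sq] at h1
    set A := Real.sqrt (∫ x, (k 0 x ^ 2 + k 1 x ^ 2)) with hA
    set B := Real.sqrt (∫ x, (g 0 x ^ 2 + g 1 x ^ 2)) with hB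
    have iA : 0 ≤ ∫ x, (k 0 x ^ 2 + k 1 x ^ 2) := integral_nonneg fun x => by positivity
    have iB : 0 ≤ ∫ x, (g 0 x ^ 2 + g 1 x ^ 2) := integral_nonneg fun x => by positivity
    have hA2 : A ^ 2 = ∫ x, (k 0 x ^ 2 + k 1 x ^ 2) := Real.sq_sqrt iA
    have hM0 : 0 ≤ M := by
      obtain ⟨x, hx⟩ := hM.exists
      exact (abs_nonneg _).trans hx
    have mK := memLp_sqrt_sq_add_sq (mk 0) (mk 1)
    have mG := memLp_sqrt_sq_add_sq (mg 0) (mg 1)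
    have h2 : - ∫ x, θ x * (g 1 x * k 0 x - g 0 x * k 1 x)
        ≤ ∫ x, M * (Real.sqrt (g 0 x ^ 2 + g 1 x ^ 2) * Real.sqrt (k 0 x ^ 2 + k 1 x ^ 2)) := by
      rw [← integral_neg]
      refine integral_mono_ae ?_ ((mG.integrable_mul mK).const_mul M) ?_
      · refine ((integrable_bdd_mul_mul mθ (mg 1) (mk 0)).sub
          (integrable_bdd_mul_mul mθ (mg 0) (mk 1))).neg.congr (.of_forall fun x => ?_)
        simp; ring
      · filter_upwards [hM] with x hx
        have h3 : |g 1 x * k 0 x - g 0 x * k 1 x|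
            ≤ Real.sqrt (g 0 x ^ 2 + g 1 x ^ 2) * Real.sqrt (k 0 x ^ 2 + k 1 x ^ 2) := by
          rw [← Real.sqrt_mul (by positivity)]
          refine Real.abs_le_sqrt ?_
          nlinarith [sq_nonneg (g 0 x * k 0 x + g 1 x * k 1 x)]
        calc -(θ x * (g 1 x * k 0 x - g 0 x * k 1 x))
            ≤ |θ x| * |g 1 x * k 0 x - g 0 x * k 1 x| := by
              rw [← abs_mul]; exact neg_le_abs _
          _ ≤ _ := mul_le_mul hx h3 (abs_nonneg _) hM0
    have h4 := (le_abs_self _).trans (abs_integral_mul_le mG mK)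
    simp only [fun x => Real.sq_sqrt (show 0 ≤ g 0 x ^ 2 + g 1 x ^ 2 by positivity),
      fun x => Real.sq_sqrt (show 0 ≤ k 0 x ^ 2 + k 1 x ^ 2 by positivity)] at h4
    rw [integral_const_mul] at h2
    have h5 : A * A ≤ M * B * A := by
      calc A * A = A ^ 2 := by ring
        _ ≤ M * ∫ x, Real.sqrt (g 0 x ^ 2 + g 1 x ^ 2) * Real.sqrt (k 0 x ^ 2 + k 1 x ^ 2) := by
          rw [hA2, h1]; exact h2
        _ ≤ M * (B * A) := by gcongr
        _ = M * B * A := by ring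
    rcases (Real.sqrt_nonneg _ : 0 ≤ A).eq_or_lt with h0 | h0
    · rw [hA, ← h0]; exact mul_nonneg hM0 (Real.sqrt_nonneg _)
    · exact le_of_mul_le_mul_right h5 h0

/-- Integration by parts in the transport term for a Lipschitz field `v`:
`∫ (v · ∇f) Δf = -∫ ∇v : ∇f ⊗ ∇f + ½ ∫ (∇ · v) |∇f|²`. -/
theorem integral_transport_mul_lap {f : Torus → ℝ} {v g : Fin 2 → Torus → ℝ}
    {D H : Fin 2 → Fin 2 → Torus → ℝ}
    (hv : ∀ i j, HasWeakPartial j (v i) (D i j)) (hf : ∀ i, HasWeakPartial i f (g i))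
    (hg : ∀ i j, HasWeakPartial j (g i) (H i j))
    (mv : ∀ i, MemLp (v i) ⊤) (mD : ∀ i j, MemLp (D i j) ⊤) (mg : ∀ i, MemLp (g i) 2)
    (mH : ∀ i j, MemLp (H i j) 2) :
    ∫ x, (v 0 x * g 0 x + v 1 x * g 1 x) * (H 0 0 x + H 1 1 x)
      = - ∫ x, (D 0 0 x * g 0 x ^ 2 + (D 0 1 x + D 1 0 x) * (g 0 x * g 1 x) + D 1 1 x * g 1 x ^ 2
        - (D 0 0 x + D 1 1 x) * (g 0 x ^ 2 + g 1 x ^ 2) / 2) := by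
  have hs := (hf 1).ae_symm (hf 0) (hg 1 0) (hg 0 1) (mH 1 0) (mH 0 1)
  have P := fun i j => (hv i j).integral_bdd_mul_mul (hg i j) (hg j j) (mv i) (mD i j) (mg i)
    (mH i j) (mg j) (mH j j)
  have R := fun i j => (hv i i).integral_bdd_mul_mul (hg j i) (hg j i) (mv i) (mD i i) (mg j)
    (mH j i) (mg j) (mH j i)
  have iv : ∀ i j k l, Integrable fun x => v i x * (H j k x * g l x) := fun i j k l =>
    integrable_bdd_mul_mul (mv i) (mH j k) (mg l)
  have iv' : ∀ i j k l, Integrable fun x => v i x * (g l x * H j k x) := fun i j k l =>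
    integrable_bdd_mul_mul (mv i) (mg l) (mH j k)
  have iD : ∀ i j k l, Integrable fun x => D i j x * (g k x * g l x) := fun i j k l =>
    integrable_bdd_mul_mul (mD i j) (mg k) (mg l)
  have S1 : ∀ i l, ∫ x, v i x * (H 0 1 x * g l x) = ∫ x, v i x * (H 1 0 x * g l x) := by
    intro i l
    refine integral_congr_ae ?_
    filter_upwards [hs] with x hx
    rw [hx]
  have C1 : ∀ i j k l, ∫ x, v i x * (g l x * H j k x) = ∫ x, v i x * (H j k x * g l x) := by
    intro i j k l; congr 1; ext x; ring
  have e1 : ∫ x, (v 0 x * g 0 x + v 1 x * g 1 x) * (H 0 0 x + H 1 1 x)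
      = (∫ x, v 0 x * (H 0 0 x * g 0 x)) + (∫ x, v 0 x * (H 1 1 x * g 0 x))
        + (∫ x, v 1 x * (H 0 0 x * g 1 x)) + (∫ x, v 1 x * (H 1 1 x * g 1 x)) := by
    rw [← integral_add (iv _ _ _ _) (iv _ _ _ _),
      ← integral_add ((iv _ _ _ _).fun_add (iv _ _ _ _)) (iv _ _ _ _),
      ← integral_add (((iv _ _ _ _).fun_add (iv _ _ _ _)).fun_add (iv _ _ _ _)) (iv _ _ _ _)]
    congr 1; ext x; ring
  have e2 : ∫ x, (D 0 0 x * g 0 x ^ 2 + (D 0 1 x + D 1 0 x) * (g 0 x * g 1 x) + D 1 1 x * g 1 x ^ 2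
        - (D 0 0 x + D 1 1 x) * (g 0 x ^ 2 + g 1 x ^ 2) / 2)
      = (1 / 2) * (∫ x, D 0 0 x * (g 0 x * g 0 x)) + (-1 / 2) * (∫ x, D 0 0 x * (g 1 x * g 1 x))
        + (1 / 2) * (∫ x, D 1 1 x * (g 1 x * g 1 x)) + (-1 / 2) * (∫ x, D 1 1 x * (g 0 x * g 0 x))
        + (∫ x, D 0 1 x * (g 0 x * g 1 x)) + ∫ x, D 1 0 x * (g 1 x * g 0 x) := by
    have i1 := (iD 0 0 0 0).const_mul (1 / 2)
    have i2 := (iD 0 0 1 1).const_mul (-1 / 2)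
    have i3 := (iD 1 1 1 1).const_mul (1 / 2)
    have i4 := (iD 1 1 0 0).const_mul (-1 / 2)
    have j2 := Integrable.fun_add i1 i2
    have j3 := j2.fun_add i3
    have j4 := j3.fun_add i4
    simp only [← integral_const_mul]
    rw [← integral_add i1 i2, ← integral_add j2 i3, ← integral_add j3 i4,
      ← integral_add j4 (iD _ _ _ _), ← integral_add (j4.fun_add (iD _ _ _ _)) (iD _ _ _ _)]
    congr 1; ext x; ring
  have P00 := P 0 0
  have P01 := P 0 1
  have P10 := P 1 0
  have P11 := P 1 1
  have R00 := R 0 0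
  have R01 := R 0 1
  have R10 := R 1 0
  have R11 := R 1 1
  simp only [C1] at P00 P01 P10 P11 R00 R01 R10 R11
  rw [e1, e2]
  linarith [S1 0 0, S1 0 1, S1 1 0, S1 1 1]

/-- The energy estimate at a fixed time. The resolved part `v` of the velocity is integrated by
parts, and the remainder `u - v` is absorbed by half of the dissipation with Young's inequality. -/
theorem integral_dt_mul_lap_le {f h w : Torus → ℝ} {u v g k : Fin 2 → Torus → ℝ}
    {D H : Fin 2 → Fin 2 → Torus → ℝ} {ν σ : ℝ} (hν : 0 < ν)
    (hv : ∀ i j, HasWeakPartial j (v i) (D i j)) (hf : ∀ i, HasWeakPartial i f (g i))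
    (hg : ∀ i j, HasWeakPartial j (g i) (H i j)) (hh : ∀ i, HasWeakPartial i h (k i))
    (mv : ∀ i, MemLp (v i) ⊤) (mD : ∀ i j, MemLp (D i j) ⊤)
    (mg : ∀ i, MemLp (g i) 2) (mH : ∀ i j, MemLp (H i j) 2) (mh : MemLp h 2)
    (mk : ∀ i, MemLp (k i) 2) (mw : MemLp w 2)
    (horth : ∫ x, (k 0 x * g 0 x + k 1 x * g 1 x) = 0)
    (heq : ∀ᵐ x, - w x - (u 0 x * g 0 x + u 1 x * g 1 x) - h x - ν * (H 0 0 x + H 1 1 x) = 0)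
    (hΛ : ∀ᵐ x, D 0 0 x * g 0 x ^ 2 + (D 0 1 x + D 1 0 x) * (g 0 x * g 1 x) + D 1 1 x * g 1 x ^ 2
        - (D 0 0 x + D 1 1 x) * (g 0 x ^ 2 + g 1 x ^ 2) / 2
        + ((u 0 x - v 0 x) * g 0 x + (u 1 x - v 1 x) * g 1 x) ^ 2 / (2 * ν)
        ≤ σ * (g 0 x ^ 2 + g 1 x ^ 2)) :
    ∫ x, w x * (H 0 0 x + H 1 1 x)
      ≤ σ * (∫ x, (g 0 x ^ 2 + g 1 x ^ 2)) - ν / 2 * ∫ x, (H 0 0 x + H 1 1 x) ^ 2 := by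
  have mτ : MemLp (fun x => H 0 0 x + H 1 1 x) 2 := (mH 0 0).add (mH 1 1)
  have mvg : MemLp (fun x => v 0 x * g 0 x + v 1 x * g 1 x) 2 :=
    ((mg 0).mul (mv 0)).add ((mg 1).mul (mv 1))
  have i1 : Integrable fun x => w x * (H 0 0 x + H 1 1 x) := mw.integrable_mul mτ
  have i2 : Integrable fun x => (v 0 x * g 0 x + v 1 x * g 1 x) * (H 0 0 x + H 1 1 x) :=
    mvg.integrable_mul mτ
  have i3 : Integrable fun x => h x * (H 0 0 x + H 1 1 x) := mh.integrable_mul mτ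
  have i4 : Integrable fun x => ν / 2 * (H 0 0 x + H 1 1 x) ^ 2 := mτ.integrable_sq.const_mul _
  have i5 : Integrable fun x => σ * (g 0 x ^ 2 + g 1 x ^ 2) :=
    ((mg 0).integrable_sq.add (mg 1).integrable_sq).const_mul _
  have iD : ∀ i j k l, Integrable fun x => D i j x * (g k x * g l x) := fun i j k l =>
    integrable_bdd_mul_mul (mD i j) (mg k) (mg l)
  have i6 : Integrable fun x => D 0 0 x * g 0 x ^ 2 + (D 0 1 x + D 1 0 x) * (g 0 x * g 1 x)
      + D 1 1 x * g 1 x ^ 2 - (D 0 0 x + D 1 1 x) * (g 0 x ^ 2 + g 1 x ^ 2) / 2 := by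
    refine ((((((iD 0 0 0 0).const_mul (1 / 2)).add ((iD 0 0 1 1).const_mul (-1 / 2))).add
      ((iD 1 1 1 1).const_mul (1 / 2))).add ((iD 1 1 0 0).const_mul (-1 / 2))).add
      ((iD 0 1 0 1).add (iD 1 0 0 1))).congr (.of_forall fun x => ?_)
    simp only [Pi.add_apply]; ring
  have hhτ : ∫ x, h x * (H 0 0 x + H 1 1 x) = 0 := by
    have a0 := (hh 0).integral_mul_eq_neg (hg 0 0) mh (mk 0) (mg 0) (mH 0 0)
    have a1 := (hh 1).integral_mul_eq_neg (hg 1 1) mh (mk 1) (mg 1) (mH 1 1)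
    have b0 : Integrable fun x => k 0 x * g 0 x := (mk 0).integrable_mul (mg 0)
    have b1 : Integrable fun x => k 1 x * g 1 x := (mk 1).integrable_mul (mg 1)
    have c0 : Integrable fun x => h x * H 0 0 x := mh.integrable_mul (mH 0 0)
    have c1 : Integrable fun x => h x * H 1 1 x := mh.integrable_mul (mH 1 1)
    rw [integral_add b0 b1] at horth
    simp only [mul_add]
    rw [integral_add c0 c1, a0, a1]
    linarith
  have htr := integral_transport_mul_lap hv hf hg mv mD mg mH
  have key : ∫ x, (w x * (H 0 0 x + H 1 1 x)
        + (v 0 x * g 0 x + v 1 x * g 1 x) * (H 0 0 x + H 1 1 x) + h x * (H 0 0 x + H 1 1 x)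
        + ν / 2 * (H 0 0 x + H 1 1 x) ^ 2
        + (D 0 0 x * g 0 x ^ 2 + (D 0 1 x + D 1 0 x) * (g 0 x * g 1 x)
      + D 1 1 x * g 1 x ^ 2 - (D 0 0 x + D 1 1 x) * (g 0 x ^ 2 + g 1 x ^ 2) / 2))
      ≤ ∫ x, σ * (g 0 x ^ 2 + g 1 x ^ 2) := by
    refine integral_mono_ae ((((i1.fun_add i2).fun_add i3).fun_add i4).fun_add i6) i5 ?_
    filter_upwards [heq, hΛ] with x hx hx'
    set z := (u 0 x - v 0 x) * g 0 x + (u 1 x - v 1 x) * g 1 x with hz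
    set τ := H 0 0 x + H 1 1 x with hτ
    have hw : w x = - (z + (v 0 x * g 0 x + v 1 x * g 1 x)) - h x - ν * τ := by
      rw [hz]; linarith
    have young : - (z * τ) ≤ z ^ 2 / (2 * ν) + ν / 2 * τ ^ 2 := by
      have : z ^ 2 / (2 * ν) + ν / 2 * τ ^ 2 + z * τ = (z + ν * τ) ^ 2 / (2 * ν) := by
        field_simp; ring
      have h0 : 0 ≤ (z + ν * τ) ^ 2 / (2 * ν) := by positivity
      linarith
    rw [hw]
    nlinarith
  rw [integral_add (((i1.fun_add i2).fun_add i3).fun_add i4) i6,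
    integral_add ((i1.fun_add i2).fun_add i3) i4, integral_add (i1.fun_add i2) i3,
    integral_add i1 i2, integral_const_mul, integral_const_mul, htr, hhτ] at key
  linarith

/-! ### The largest positive eigenvalue of a symmetric matrix -/

theorem hasEigenvalue_toLin'_iff (A : Matrix (Fin 2) (Fin 2) ℝ) (μ : ℝ) :
    Module.End.HasEigenvalue (Matrix.toLin' A) μ ↔
      (μ - A 0 0) * (μ - A 1 1) = A 0 1 * A 1 0 := by
  rw [Module.End.hasEigenvalue_iff_isRoot_charpoly, Matrix.charpoly_toLin',
    Matrix.charpoly_fin_two, Polynomial.IsRoot.def, Matrix.trace_fin_two, Matrix.det_fin_two]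
  simp only [Polynomial.eval_add, Polynomial.eval_sub, Polynomial.eval_mul, Polynomial.eval_pow,
    Polynomial.eval_X, Polynomial.eval_C]
  constructor <;> intro h <;> linarith

/-- The larger root of the characteristic polynomial of a symmetric `2 × 2` matrix. -/
noncomputable def topEig (A : Matrix (Fin 2) (Fin 2) ℝ) : ℝ :=
  (A 0 0 + A 1 1) / 2 + Real.sqrt (((A 0 0 - A 1 1) / 2) ^ 2 + A 0 1 ^ 2)

theorem sigmaPlus_eq_max {A : Matrix (Fin 2) (Fin 2) ℝ} (hA : A 1 0 = A 0 1) :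
    sigmaPlus A = max 0 (topEig A) := by
  have hr := Real.sq_sqrt (show 0 ≤ ((A 0 0 - A 1 1) / 2) ^ 2 + A 0 1 ^ 2 by positivity)
  have hr0 := Real.sqrt_nonneg (((A 0 0 - A 1 1) / 2) ^ 2 + A 0 1 ^ 2)
  have hle : ∀ μ, Module.End.HasEigenvalue (Matrix.toLin' A) μ → μ ≤ topEig A := by
    intro μ hμ
    rw [hasEigenvalue_toLin'_iff, hA] at hμ
    unfold topEig
    have : (μ - (A 0 0 + A 1 1) / 2) ^ 2
        = Real.sqrt (((A 0 0 - A 1 1) / 2) ^ 2 + A 0 1 ^ 2) ^ 2 := by rw [hr]; linarith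
    have := abs_le.1 (abs_le_of_sq_le_sq this.le hr0)
    linarith [this.2]
  have heig : Module.End.HasEigenvalue (Matrix.toLin' A) (topEig A) := by
    rw [hasEigenvalue_toLin'_iff, hA]
    unfold topEig
    linarith
  unfold sigmaPlus
  by_cases h : 0 < topEig A
  · rw [max_eq_right h.le]
    exact IsGreatest.csSup_eq ⟨⟨h, heig⟩, fun μ hμ => hle μ hμ.2⟩
  · rw [max_eq_left (not_lt.1 h)]
    have : {μ : ℝ | 0 < μ ∧ Module.End.HasEigenvalue (Matrix.toLin' A) μ} = ∅ := by
      ext μ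
      simp only [mem_ofPred_eq, mem_empty_iff_false, iff_false, not_and]
      exact fun h0 hμ => h (h0.trans_le (hle μ hμ))
    rw [this, Real.sSup_empty]

theorem quadForm_le_sigmaPlus {A : Matrix (Fin 2) (Fin 2) ℝ} (hA : A 1 0 = A 0 1) (x y : ℝ) :
    A 0 0 * x ^ 2 + 2 * A 0 1 * (x * y) + A 1 1 * y ^ 2 ≤ sigmaPlus A * (x ^ 2 + y ^ 2) := by
  have h1 : topEig A ≤ sigmaPlus A := by rw [sigmaPlus_eq_max hA]; exact le_max_right _ _
  refine le_trans ?_ (mul_le_mul_of_nonneg_right h1 (by positivity))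
  have hr := Real.sq_sqrt (show 0 ≤ ((A 0 0 - A 1 1) / 2) ^ 2 + A 0 1 ^ 2 by positivity)
  have hr0 := Real.sqrt_nonneg (((A 0 0 - A 1 1) / 2) ^ 2 + A 0 1 ^ 2)
  unfold topEig
  set r := Real.sqrt (((A 0 0 - A 1 1) / 2) ^ 2 + A 0 1 ^ 2)
  -- Cauchy-Schwarz for the vectors `((a - d) / 2, b)` and `(x² - y², 2xy)`
  have h2 : ((A 0 0 - A 1 1) / 2) * (x ^ 2 - y ^ 2) + A 0 1 * (2 * (x * y))
      ≤ r * (x ^ 2 + y ^ 2) := by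
    refine le_of_sq_le_sq ?_ (by positivity)
    rw [mul_pow, hr]
    nlinarith [sq_nonneg ((A 0 0 - A 1 1) / 2 * (2 * (x * y)) - A 0 1 * (x ^ 2 - y ^ 2))]
  linarith

theorem sigmaPlus_nonneg (A : Matrix (Fin 2) (Fin 2) ℝ) : 0 ≤ sigmaPlus A :=
  Real.sSup_nonneg fun _ h => h.1.le

theorem sigmaPlus_le {A : Matrix (Fin 2) (Fin 2) ℝ} (hA : A 1 0 = A 0 1) {m : ℝ}
    (h : ∀ i j, |A i j| ≤ m) : sigmaPlus A ≤ 3 * m := by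
  have h00 := abs_le.1 (h 0 0)
  have h11 := abs_le.1 (h 1 1)
  have h01 := abs_le.1 (h 0 1)
  rw [sigmaPlus_eq_max hA]
  refine max_le (by linarith) ?_
  have : Real.sqrt (((A 0 0 - A 1 1) / 2) ^ 2 + A 0 1 ^ 2) ≤ 2 * m :=
    Real.sqrt_le_iff.2 ⟨by linarith, by nlinarith⟩
  unfold topEig
  linarith

theorem Lam_apply (ν : ℝ) (D : Matrix (Fin 2) (Fin 2) ℝ) (w : E2) :
    Lam ν D w 0 0 = (D 0 0 - D 1 1) / 2 + w 0 ^ 2 / (2 * ν) ∧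
    Lam ν D w 0 1 = (D 0 1 + D 1 0) / 2 + w 0 * w 1 / (2 * ν) ∧
    Lam ν D w 1 0 = (D 0 1 + D 1 0) / 2 + w 0 * w 1 / (2 * ν) ∧
    Lam ν D w 1 1 = (D 1 1 - D 0 0) / 2 + w 1 ^ 2 / (2 * ν) := by
  refine ⟨?_, ?_, ?_, ?_⟩ <;>
  simp [Lam, Matrix.trace_fin_two, Matrix.vecMulVec_apply] <;> ring

theorem Lam_symm (ν : ℝ) (D : Matrix (Fin 2) (Fin 2) ℝ) (w : E2) :
    Lam ν D w 1 0 = Lam ν D w 0 1 := by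
  rw [(Lam_apply ν D w).2.1, (Lam_apply ν D w).2.2.1]

theorem Lam_quadForm_le (ν : ℝ) (D : Matrix (Fin 2) (Fin 2) ℝ) (w : E2) (x y : ℝ) :
    D 0 0 * x ^ 2 + (D 0 1 + D 1 0) * (x * y) + D 1 1 * y ^ 2
        - (D 0 0 + D 1 1) * (x ^ 2 + y ^ 2) / 2 + (w 0 * x + w 1 * y) ^ 2 / (2 * ν)
      ≤ sigmaPlus (Lam ν D w) * (x ^ 2 + y ^ 2) := by
  refine le_trans (le_of_eq ?_) (quadForm_le_sigmaPlus (Lam_symm ν D w) x y)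
  obtain ⟨h1, h2, -, h4⟩ := Lam_apply ν D w
  rw [h1, h2, h4]
  ring

theorem sigmaPlus_Lam_le {ν K : ℝ} (hν : 0 < ν) {D : Matrix (Fin 2) (Fin 2) ℝ} {w : E2}
    (hD : ∀ i j, |D i j| ≤ K) (hw : ‖w‖ ^ 2 ≤ K * ν) : sigmaPlus (Lam ν D w) ≤ 6 * K := by
  have hw2 : w 0 ^ 2 + w 1 ^ 2 ≤ K * ν := by
    rw [EuclideanSpace.norm_sq_eq, Fin.sum_univ_two] at hw
    simpa using hw
  have q : ∀ z, |z| ≤ K * ν → |z / (2 * ν)| ≤ K / 2 := by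
    intro z hz
    rw [abs_div, abs_of_pos (by positivity : 0 < 2 * ν), div_le_iff₀ (by positivity)]
    linarith
  have q0 := abs_le.1 (q (w 0 ^ 2) (by rw [abs_of_nonneg (sq_nonneg _)]; nlinarith [sq_nonneg (w 1)]))
  have q1 := abs_le.1 (q (w 1 ^ 2) (by rw [abs_of_nonneg (sq_nonneg _)]; nlinarith [sq_nonneg (w 0)]))
  have q2 := abs_le.1 (q (w 0 * w 1) (abs_le.2 ⟨by nlinarith [sq_nonneg (w 0 + w 1)],
    by nlinarith [sq_nonneg (w 0 - w 1)]⟩))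
  have d00 := abs_le.1 (hD 0 0)
  have d01 := abs_le.1 (hD 0 1)
  have d10 := abs_le.1 (hD 1 0)
  have d11 := abs_le.1 (hD 1 1)
  obtain ⟨h1, h2, h3, h4⟩ := Lam_apply ν D w
  refine (sigmaPlus_le (m := 2 * K) (Lam_symm ν D w) ?_).trans (by linarith)
  intro i j
  fin_cases i <;> fin_cases j <;> simp only [Fin.zero_eta, Fin.mk_one] <;>
    [rw [h1]; rw [h2]; rw [h3]; rw [h4]] <;> exact abs_le.2 ⟨by linarith, by linarith⟩

/-- If all eigenvalues of `Λ` are at most `ε`, then the small scales and the trace-free part of the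
symmetric gradient are small: `Λ` has trace `|u'|² / (2ν)`, and `u' ⊗ u'` is nonnegative. -/
theorem bounds_of_sigmaPlus_Lam_le {ν ε : ℝ} (hν : 0 < ν) {D : Matrix (Fin 2) (Fin 2) ℝ} {w : E2}
    (h : sigmaPlus (Lam ν D w) ≤ ε) :
    ‖w‖ ^ 2 ≤ 4 * ε * ν ∧ |D 0 0 - D 1 1| ≤ 2 * ε ∧ |D 0 1 + D 1 0| ≤ 2 * ε := by
  have Q := Lam_quadForm_le ν D w
  have Q1 := Q 1 0
  have Q2 := Q 0 1
  have Q3 := Q 1 1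
  have Q4 := Q 1 (-1)
  have n0 : 0 ≤ w 0 ^ 2 / (2 * ν) := by positivity
  have n1 : 0 ≤ w 1 ^ 2 / (2 * ν) := by positivity
  have n2 : 0 ≤ (w 0 + w 1) ^ 2 / (2 * ν) := by positivity
  have n3 : 0 ≤ (w 0 - w 1) ^ 2 / (2 * ν) := by positivity
  have e3 : (w 0 * 1 + w 1 * -1) = w 0 - w 1 := by ring
  rw [e3] at Q4
  simp only [mul_one, mul_zero, add_zero, zero_add] at Q1 Q2 Q3
  refine ⟨?_, abs_le.2 ⟨by linarith, by linarith⟩, abs_le.2 ⟨by linarith, by linarith⟩⟩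
  have : w 0 ^ 2 / (2 * ν) + w 1 ^ 2 / (2 * ν) ≤ 2 * ε := by linarith
  rw [← add_div, div_le_iff₀ (by positivity)] at this
  rw [EuclideanSpace.norm_sq_eq, Fin.sum_univ_two]
  simp only [Real.norm_eq_abs, sq_abs]
  linarith

/-! ### The energy identity -/

/-- The fundamental theorem of calculus for the square of an absolutely continuous function. -/
theorem sq_sub_sq_eq_integral {F f : ℝ → ℝ} {a b : ℝ} (hab : a ≤ b)
    (hf : IntervalIntegrable f volume a b)
    (hF : ∀ t ∈ Icc a b, F t = F a + ∫ r in a..t, f r) :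
    F b ^ 2 - F a ^ 2 = ∫ r in a..b, 2 * (F r * f r) := by
  set G : ℝ → ℝ := fun t => F a + ∫ r in a..t, f r with hG
  have hGac : AbsolutelyContinuousOnInterval G a b :=
    (LipschitzOnWith.absolutelyContinuousOnInterval (K := 0)
      ((LipschitzWith.const (F a)).lipschitzOnWith)).add
      (hf.absolutelyContinuousOnInterval_intervalIntegral left_mem_uIcc)
  have key := hGac.integral_deriv_mul_eq_sub hGac
  have e1 : G a = F a := by simp [hG]
  have e2 : G b = F b := (hF b (right_mem_Icc.2 hab)).symm
  rw [e1, e2, ← sq, ← sq] at key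
  rw [← key]
  refine intervalIntegral.integral_congr_ae ?_
  filter_upwards [hf.ae_hasDerivAt_integral] with x hx hx'
  have hxI : x ∈ uIcc a b := uIoc_subset_uIcc hx'
  have hd : deriv G x = f x := ((hx hxI a left_mem_uIcc).const_add (F a)).deriv
  have hGx : G x = F x := (hF x (by rwa [uIcc_of_le hab] at hxI)).symm
  rw [hd, hGx]
  ring

theorem norm_sq_sub_norm_sq_eq_integral {c d : ℝ → ℂ} {a b : ℝ} (hab : a ≤ b)
    (hd : IntervalIntegrable d volume a b)
    (hc : ∀ t ∈ Icc a b, c t - c a = ∫ r in a..t, d r) :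
    ‖c b‖ ^ 2 - ‖c a‖ ^ 2 = ∫ r in a..b, 2 * (conj (c r) * d r).re := by
  have hdre : IntervalIntegrable (fun r => (d r).re) volume a b := ⟨hd.1.re, hd.2.re⟩
  have hdim : IntervalIntegrable (fun r => (d r).im) volume a b := ⟨hd.1.im, hd.2.im⟩
  have sub : ∀ t ∈ Icc a b, IntervalIntegrable d volume a t := fun t ht =>
    hd.mono_set (by rw [uIcc_of_le hab, uIcc_of_le ht.1]; exact Icc_subset_Icc_right ht.2)
  have hre : ∀ t ∈ Icc a b, (c t).re = (c a).re + ∫ r in a..t, (d r).re := by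
    intro t ht
    have := Complex.reCLM.intervalIntegral_comp_comm (sub t ht)
    simp only [Complex.reCLM_apply] at this
    rw [this, ← hc t ht]; simp
  have him : ∀ t ∈ Icc a b, (c t).im = (c a).im + ∫ r in a..t, (d r).im := by
    intro t ht
    have := Complex.imCLM.intervalIntegral_comp_comm (sub t ht)
    simp only [Complex.imCLM_apply] at this
    rw [this, ← hc t ht]; simp
  have cont : ∀ {F f : ℝ → ℝ}, IntervalIntegrable f volume a b →
      (∀ t ∈ Icc a b, F t = F a + ∫ r in a..t, f r) → ContinuousOn F (uIcc a b) := by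
    intro F f hf hF
    refine ((continuousOn_const (c := F a)).add
      (intervalIntegral.continuousOn_primitive_interval' hf left_mem_uIcc)).congr ?_
    intro t ht
    exact hF t (by rwa [uIcc_of_le hab] at ht)
  have k1 := sq_sub_sq_eq_integral hab hdre hre
  have k2 := sq_sub_sq_eq_integral hab hdim him
  have i1 : IntervalIntegrable (fun r => 2 * ((c r).re * (d r).re)) volume a b :=
    (hdre.continuousOn_mul (cont hdre hre)).const_mul 2
  have i2 : IntervalIntegrable (fun r => 2 * ((c r).im * (d r).im)) volume a b :=
    (hdim.continuousOn_mul (cont hdim him)).const_mul 2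
  rw [← Complex.normSq_eq_norm_sq, ← Complex.normSq_eq_norm_sq, Complex.normSq_apply,
    Complex.normSq_apply]
  have e : ∀ r, 2 * (conj (c r) * d r).re = 2 * ((c r).re * (d r).re) + 2 * ((c r).im * (d r).im) := by
    intro r; simp; ring
  simp only [e]
  rw [intervalIntegral.integral_add i1 i2, ← k1, ← k2]
  ring

theorem slab_eq_Ioc (T : ℝ) : slab T = (volume.restrict (Ioc 0 T)).prod volume := by
  rw [slab, Measure.restrict_congr_set Ioo_ae_eq_Ioc]

instance (T : ℝ) : IsFiniteMeasure (slab T) := by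
  unfold slab; infer_instance

theorem intervalIntegrable_of_restrict_Ioo {E : Type*} [NormedAddCommGroup E] {T s t : ℝ} {f : ℝ → E}
    (hf : Integrable f (volume.restrict (Ioo 0 T))) (hs : s ∈ Icc 0 T) (ht : t ∈ Icc 0 T) :
    IntervalIntegrable f volume s t := by
  have h : IntervalIntegrable f volume 0 T :=
    (intervalIntegrable_iff_integrableOn_Ioo_of_le (hs.1.trans hs.2)).2 hf
  refine h.mono_set ?_
  rw [uIcc_of_le (hs.1.trans hs.2)]
  exact uIcc_subset_Icc hs ht

theorem integrable_coef {T : ℝ} {w : ℝ → Torus → ℝ} (hw : Integrable (Function.uncurry w) (slab T))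
    (k : Fin 2 → ℤ) : Integrable (fun t => coef (w t) k) (volume.restrict (Ioo 0 T)) := by
  refine Integrable.integral_prod_left (f := fun p : ℝ × Torus => mFourier (-k) p.2 * (w p.1 p.2 : ℂ)) ?_
  exact Integrable.bdd_mul (c := 1) hw.ofReal (by fun_prop)
    (.of_forall fun x => ((mFourier (-k)).norm_coe_le_norm _).trans mFourier_norm.le)

/-- Integration in time commutes with Fourier coefficients. -/
theorem coef_sub_coef_eq_integral {T : ℝ} {φ w : ℝ → Torus → ℝ}
    (hw : Integrable (Function.uncurry w) (slab T)) {s t : ℝ} (hs : s ∈ Icc 0 T) (ht : t ∈ Icc 0 T)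
    (iφs : Integrable (φ s)) (iφt : Integrable (φ t))
    (hdt : ∀ᵐ x : Torus, φ t x - φ s x = ∫ r in s..t, w r x) (k : Fin 2 → ℤ) :
    coef (φ t) k - coef (φ s) k = ∫ r in s..t, coef (w r) k := by
  have hint : Integrable (fun p : ℝ × Torus => mFourier (-k) p.2 * (w p.1 p.2 : ℂ)) (slab T) :=
    Integrable.bdd_mul (c := 1) hw.ofReal (by fun_prop)
      (.of_forall fun x => ((mFourier (-k)).norm_coe_le_norm _).trans mFourier_norm.le)
  rw [slab_eq_Ioc] at hint
  unfold coef
  rw [intervalIntegral_integral_swap (f := fun r x => mFourier (-k) x * (w r x : ℂ)),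
    ← integral_sub (integrable_mFourier_mul iφt _) (integrable_mFourier_mul iφs _)]
  · refine integral_congr_ae ?_
    filter_upwards [hdt] with x hx
    rw [intervalIntegral.integral_const_mul, intervalIntegral.integral_ofReal, ← hx]
    push_cast; ring
  · refine hint.mono_measure (Measure.prod_mono (Measure.restrict_mono ?_ le_rfl) le_rfl)
    rw [uIoc]
    exact Ioc_subset_Ioc (le_min hs.1 ht.1) (max_le hs.2 ht.2)

/-- The energy identity `‖∇φ(T)‖² - ‖∇φ(s)‖² = -2 ∫ₛᵀ ∫ ∂ₜφ Δφ`, obtained frequency by frequency: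
each Fourier coefficient of `φ` is absolutely continuous in time. -/
theorem energy_identity {T : ℝ} {φ w : ℝ → Torus → ℝ} {g : Fin 2 → ℝ → Torus → ℝ}
    {H : Fin 2 → Fin 2 → ℝ → Torus → ℝ} (mw : MemLp (Function.uncurry w) 2 (slab T))
    (mL : MemLp (Function.uncurry fun t x => H 0 0 t x + H 1 1 t x) 2 (slab T))
    (mφ : ∀ t ∈ Icc 0 T, MemLp (φ t) 2) (mg : ∀ t ∈ Icc 0 T, ∀ i, MemLp (g i t) 2)
    (hφ : ∀ t ∈ Icc 0 T, ∀ i, HasWeakPartial i (φ t) (g i t))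
    (hg : ∀ᵐ t ∂(volume.restrict (Ioo 0 T)), ∀ i j, HasWeakPartial j (g i t) (H i j t))
    (mw' : ∀ᵐ t ∂(volume.restrict (Ioo 0 T)), MemLp (w t) 2)
    (mL' : ∀ᵐ t ∂(volume.restrict (Ioo 0 T)), MemLp (fun x => H 0 0 t x + H 1 1 t x) 2)
    (mH' : ∀ᵐ t ∂(volume.restrict (Ioo 0 T)), ∀ i j, MemLp (H i j t) 2)
    (hdt : ∀ s ∈ Icc 0 T, ∀ t ∈ Icc 0 T, ∀ᵐ x : Torus, φ t x - φ s x = ∫ r in s..t, w r x)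
    {s : ℝ} (hs : s ∈ Icc 0 T) :
    (∫ x, (g 0 T x ^ 2 + g 1 T x ^ 2)) - ∫ x, (g 0 s x ^ 2 + g 1 s x ^ 2)
      = ∫ r in s..T, -2 * ∫ x, w r x * (H 0 0 r x + H 1 1 r x) := by
  have hT : T ∈ Icc 0 T := ⟨hs.1.trans hs.2, le_rfl⟩
  have iw : Integrable (Function.uncurry w) (slab T) := mw.integrable one_le_two
  have iL : Integrable (Function.uncurry fun t x => H 0 0 t x + H 1 1 t x) (slab T) :=
    mL.integrable one_le_two
  -- `lam` is the Fourier symbol of `-Δ`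
  set lam : (Fin 2 → ℤ) → ℝ := fun k => ‖symb 0 k‖ ^ 2 + ‖symb 1 k‖ ^ 2 with hlam
  have hsq : ∀ i k, ((‖symb i k‖ ^ 2 : ℝ) : ℂ) = - (symb i k * symb i k) := by
    intro i k
    rw [← Complex.normSq_eq_norm_sq, Complex.normSq_eq_conj_mul_self, conj_symb]; ring
  have hy : ∀ t ∈ Icc 0 T, HasSum (fun k => lam k * ‖coef (φ t) k‖ ^ 2)
      (∫ x, (g 0 t x ^ 2 + g 1 t x ^ 2)) := by
    intro t ht
    rw [integral_add (mg t ht 0).integrable_sq (mg t ht 1).integrable_sq]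
    refine ((hasSum_coef_sq (mg t ht 0)).add (hasSum_coef_sq (mg t ht 1))).congr_fun fun k => ?_
    rw [(hφ t ht 0).coef_eq, (hφ t ht 1).coef_eq, norm_mul, norm_mul]
    simp only [hlam]; ring
  have hlap : ∀ᵐ t ∂(volume.restrict (Ioo 0 T)), ∀ k,
      coef (fun x => H 0 0 t x + H 1 1 t x) k = - (lam k * coef (φ t) k) := by
    filter_upwards [hg, mH', ae_restrict_mem measurableSet_Ioo] with t h1 h2 ht k
    have ht' := Ioo_subset_Icc_self ht
    have e : coef (fun x => H 0 0 t x + H 1 1 t x) k = coef (H 0 0 t) k + coef (H 1 1 t) k := by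
      unfold coef
      rw [← integral_add (integrable_mFourier_mul ((h2 0 0).integrable one_le_two) _)
        (integrable_mFourier_mul ((h2 1 1).integrable one_le_two) _)]
      congr 1; ext x; push_cast; ring
    rw [e, (h1 0 0).coef_eq, (h1 1 1).coef_eq, (hφ t ht' 0).coef_eq, (hφ t ht' 1).coef_eq]
    simp only [hlam]
    rw [Complex.ofReal_add, hsq, hsq]
    ring
  have hmem : ∀ {P : ℝ → Prop}, (∀ᵐ t ∂(volume.restrict (Ioo 0 T)), P t) →
      ∀ᵐ t, t ∈ uIoc s T → P t := by
    intro P hP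
    rw [Measure.restrict_congr_set Ioo_ae_eq_Ioc, ae_restrict_iff' measurableSet_Ioc] at hP
    filter_upwards [hP] with t ht hts
    rw [uIoc_of_le hs.2] at hts
    exact ht ⟨hs.1.trans_lt hts.1, hts.2⟩
  have hterm : ∀ k, lam k * ‖coef (φ T) k‖ ^ 2 - lam k * ‖coef (φ s) k‖ ^ 2
      = ∫ r in s..T, -2 * (conj (coef (w r) k)
        * coef (fun x => H 0 0 r x + H 1 1 r x) k).re := by
    intro k
    have h1 := norm_sq_sub_norm_sq_eq_integral (c := fun t => coef (φ t) k) hs.2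
      (intervalIntegrable_of_restrict_Ioo (integrable_coef iw k) hs hT) (fun t ht => by
        have ht' : t ∈ Icc 0 T := ⟨hs.1.trans ht.1, ht.2⟩
        exact coef_sub_coef_eq_integral iw hs ht' ((mφ s hs).integrable one_le_two)
          ((mφ t ht').integrable one_le_two) (hdt s hs t ht') k)
    rw [← mul_sub, h1, ← intervalIntegral.integral_const_mul]
    refine intervalIntegral.integral_congr_ae ?_
    filter_upwards [hmem hlap] with r hr hrs
    rw [hr hrs k]
    simp; ring
  have hsum := ((hy T hT).sub (hy s hs))
  simp only [hterm] at hsum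
  refine hsum.unique ?_
  -- time integration and the sum over frequencies are exchanged by dominated convergence; the sum
  -- of the bounds is integrable by Parseval's identity
  set bound : (Fin 2 → ℤ) → ℝ → ℝ := fun k r => ‖coef (w r) k‖ ^ 2
    + ‖coef (fun x => H 0 0 r x + H 1 1 r x) k‖ ^ 2 with hbound
  have hbsum : ∀ᵐ t ∂(volume.restrict (Ioo 0 T)), HasSum (fun k => bound k t)
      ((∫ x, w t x ^ 2) + ∫ x, (H 0 0 t x + H 1 1 t x) ^ 2) := by
    filter_upwards [mw', mL'] with t h1 h2
    exact (hasSum_coef_sq h1).add (hasSum_coef_sq h2)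
  refine intervalIntegral.hasSum_integral_of_dominated_convergence bound ?_ ?_ ?_ ?_ ?_
  · intro k
    have m1 := (intervalIntegrable_of_restrict_Ioo (integrable_coef iw k) hs hT).def'.1
    have m2 := (intervalIntegrable_of_restrict_Ioo (integrable_coef iL k) hs hT).def'.1
    exact ((Complex.continuous_re.comp_aestronglyMeasurable
      ((Complex.continuous_conj.comp_aestronglyMeasurable m1).mul m2)).const_mul (-2))
  · intro k
    refine .of_forall fun t _ => ?_
    rw [norm_mul]
    have h1 := Complex.abs_re_le_norm (conj (coef (w t) k)
      * coef (fun x => H 0 0 t x + H 1 1 t x) k)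
    rw [norm_mul, RCLike.norm_conj] at h1
    simp only [hbound, Real.norm_eq_abs, abs_neg, Nat.abs_ofNat]
    nlinarith [sq_nonneg (‖coef (w t) k‖ - ‖coef (fun x => H 0 0 t x + H 1 1 t x) k‖)]
  · filter_upwards [hmem hbsum] with t ht hts
    exact (ht hts).summable
  · have j1 := mw.integrable_sq.integral_prod_left
    have j2 := mL.integrable_sq.integral_prod_left
    refine (intervalIntegrable_of_restrict_Ioo (j1.add j2) hs hT).congr_ae ?_
    rw [EventuallyEq, ae_restrict_iff' measurableSet_uIoc]
    filter_upwards [hmem hbsum] with t ht hts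
    exact (ht hts).tsum_eq.symm
  · have : ∀ᵐ t ∂(volume.restrict (Ioo 0 T)), HasSum (fun k => -2 * (conj (coef (w t) k)
        * coef (fun x => H 0 0 t x + H 1 1 t x) k).re)
        (-2 * ∫ x, w t x * (H 0 0 t x + H 1 1 t x)) := by
      filter_upwards [mw', mL'] with t h1 h2
      exact (hasSum_coef_inner h1 h2).mul_left (-2)
    exact hmem this

/-! ### Stability of the dual problem -/

/-- Backward Grönwall inequality in integral form. -/
theorem gronwall_backward {y : ℝ → ℝ} {T σ a P s : ℝ} (hσ : 0 ≤ σ) (hs : s ∈ Icc 0 T)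
    (hy : ContinuousOn y (Icc 0 T))
    (h : ∀ t ∈ Icc 0 T, y t ≤ a + 2 * σ * ∫ r in t..T, y r)
    (hsP : y s + P ≤ a + 2 * σ * ∫ r in s..T, y r) :
    y s + P ≤ Real.exp (2 * σ * (T - s)) * a := by
  have h0T : (0 : ℝ) ≤ T := hs.1.trans hs.2
  set G : ℝ → ℝ := fun t => (a + 2 * σ * ∫ r in t..T, y r) * Real.exp (2 * σ * t) with hG
  have hint : IntervalIntegrable y volume 0 T := hy.intervalIntegrable_of_Icc h0T
  have hcont : ContinuousOn (fun t => ∫ r in t..T, y r) (Icc 0 T) := by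
    have := intervalIntegral.continuousOn_primitive_interval' hint.symm
      (left_mem_uIcc : T ∈ uIcc T 0)
    rw [uIcc_of_ge h0T] at this
    refine this.neg.congr fun t _ => ?_
    exact intervalIntegral.integral_symm _ _
  have hderiv : ∀ t ∈ Ioo 0 T, HasDerivAt G (2 * σ * (a + 2 * σ * (∫ r in t..T, y r) - y t)
      * Real.exp (2 * σ * t)) t := by
    intro t ht
    have h1 : HasDerivAt (fun t => ∫ r in t..T, y r) (-y t) t := by
      refine intervalIntegral.integral_hasDerivAt_left
        (hint.mono_set (by rw [uIcc_of_le ht.2.le, uIcc_of_le h0T]; exact Icc_subset_Icc_left ht.1.le))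
        ?_ (hy.continuousAt (Icc_mem_nhds ht.1 ht.2))
      exact ContinuousOn.stronglyMeasurableAtFilter isOpen_Ioo (hy.mono Ioo_subset_Icc_self) t ht
    have h2 : HasDerivAt (fun t => Real.exp (2 * σ * t)) (Real.exp (2 * σ * t) * (2 * σ)) t := by
      simpa using ((hasDerivAt_id t).const_mul (2 * σ)).exp
    refine (((h1.const_mul (2 * σ)).const_add a).mul h2).congr_deriv ?_
    ring
  have hmono : MonotoneOn G (Icc 0 T) := by
    refine monotoneOn_of_deriv_nonneg (convex_Icc _ _)
      ((continuousOn_const.add (continuousOn_const.mul hcont)).mul (by fun_prop)) ?_ ?_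
    · rw [interior_Icc]
      exact fun t ht => (hderiv t ht).differentiableAt.differentiableWithinAt
    · rw [interior_Icc]
      intro t ht
      rw [(hderiv t ht).deriv]
      have := h t (Ioo_subset_Icc_self ht)
      exact mul_nonneg (mul_nonneg (by positivity) (by linarith)) (Real.exp_pos _).le
  have h1 := hmono hs (right_mem_Icc.2 h0T) hs.2
  simp only [hG, intervalIntegral.integral_same, mul_zero, add_zero] at h1
  refine hsP.trans ?_
  rw [show 2 * σ * (T - s) = 2 * σ * T - 2 * σ * s by ring, Real.exp_sub,
    div_mul_eq_mul_div, le_div_iff₀ (Real.exp_pos _)]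
  linarith

theorem MemLp.ae_slice_top {T : ℝ} {E : Type*} [NormedAddCommGroup E] {f : ℝ → Torus → E}
    (hf : MemLp (Function.uncurry f) ⊤ (slab T)) :
    ∀ᵐ t ∂(volume.restrict (Ioo 0 T)), MemLp (f t) ⊤ := by
  have h1 : ∀ᵐ t ∂(volume.restrict (Ioo 0 T)), AEStronglyMeasurable (f t) volume :=
    hf.1.prodMk_left
  have h2 : ∀ᵐ t ∂(volume.restrict (Ioo 0 T)), ∀ᵐ x, ‖f t x‖
      ≤ (eLpNorm (Function.uncurry f) ⊤ (slab T)).toReal :=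
    Measure.ae_ae_of_ae_prod (ae_norm_le_toReal_eLpNorm_top hf)
  filter_upwards [h1, h2] with t ht1 ht2
  exact memLp_top_of_bound ht1 _ ht2

theorem MemLp.ae_slice_two {T : ℝ} {E : Type*} [NormedAddCommGroup E] {f : ℝ → Torus → E}
    (hf : MemLp (Function.uncurry f) 2 (slab T)) :
    ∀ᵐ t ∂(volume.restrict (Ioo 0 T)), MemLp (f t) 2 := by
  have h1 : ∀ᵐ t ∂(volume.restrict (Ioo 0 T)), AEStronglyMeasurable (f t) volume :=
    hf.1.prodMk_left
  have h2 : ∀ᵐ t ∂(volume.restrict (Ioo 0 T)), Integrable (fun x => ‖f t x‖ ^ 2) :=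
    ((memLp_two_iff_integrable_sq_norm hf.1).1 hf).prod_right_ae
  filter_upwards [h1, h2] with t ht1 ht2
  exact (memLp_two_iff_integrable_sq_norm ht1).2 ht2

theorem MemLp.apply_E2 {α : Type*} [MeasurableSpace α] {μ : Measure α} {p : ℝ≥0∞} {f : α → E2}
    (hf : MemLp f p μ) (i : Fin 2) : MemLp (fun x => f x i) p μ :=
  (EuclideanSpace.proj (𝕜 := ℝ) i).comp_memLp' hf

theorem eLpNorm_two_eq_ofReal_sqrt {α E : Type*} [MeasurableSpace α] {μ : Measure α}
    [NormedAddCommGroup E] {f : α → E} (hf : MemLp f 2 μ) :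
    eLpNorm f 2 μ = ENNReal.ofReal (Real.sqrt (∫ x, ‖f x‖ ^ 2 ∂μ)) := by
  rw [hf.eLpNorm_eq_integral_rpow_norm (by simp) (by simp)]
  simp [Real.sqrt_eq_rpow]

theorem E2.norm_sq (x : E2) : ‖x‖ ^ 2 = x 0 ^ 2 + x 1 ^ 2 := by
  rw [EuclideanSpace.norm_sq_eq, Fin.sum_univ_two]; simp

theorem E2.inner_eq (x y : E2) : inner ℝ x y = x 0 * y 0 + x 1 * y 1 := by
  rw [PiLp.inner_apply, Fin.sum_univ_two]; simp [mul_comm]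

theorem E2.inner_rotOf (x y : E2) : inner ℝ x (rotOf y) = x 0 * y 1 - x 1 * y 0 := by
  rw [E2.inner_eq]; simp [rotOf]; ring

section

variable {ν T : ℝ} {u gω : ℝ → Torus → E2} {ωh : ℝ → Torus → ℝ} {ξ : Torus → ℝ} {gξ : Torus → E2}
  {φ₁ w : ℝ → Torus → ℝ} {g₁ : ℝ → Torus → E2} {H₁ : ℝ → Torus → Matrix (Fin 2) (Fin 2) ℝ}
  {φ₂ : ℝ → Torus → ℝ} {g₂ : ℝ → Torus → E2}

theorem IsDualSolution.memLp_lap (hS : IsDualSolution ν T u gω ξ φ₁ w g₁ H₁ φ₂ g₂) :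
    MemLp (Function.uncurry fun t x => H₁ t x 0 0 + H₁ t x 1 1) 2 (slab T) :=
  (hS.memLp_hess₁ 0 0).add (hS.memLp_hess₁ 1 1)

/-- The elliptic estimate and the orthogonality for almost every time slice of a dual solution. -/
theorem IsDualSolution.ae_elliptic (hS : IsDualSolution ν T u gω ξ φ₁ w g₁ H₁ φ₂ g₂)
    (hω : MemLinftyW1 T ωh gω) :
    ∀ᵐ t ∂(volume.restrict (Ioo 0 T)),
      (∫ x, (g₂ t x 0 * g₁ t x 0 + g₂ t x 1 * g₁ t x 1) = 0) ∧
      eLpNorm (g₂ t) 2 volume ≤ eLpNorm (ωh t) ⊤ volume * eLpNorm (g₁ t) 2 volume := by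
  have hH : ∀ᵐ t ∂(volume.restrict (Ioo 0 T)), ∀ i j, MemLp (fun x => H₁ t x i j) 2 :=
    ae_all_iff.2 fun i => ae_all_iff.2 fun j =>
      MemLp.ae_slice_two (f := fun t x => H₁ t x i j) (hS.memLp_hess₁ i j)
  filter_upwards [ae_restrict_mem measurableSet_Ioo, hS.hess₁, hS.grad₂, hS.eq₂, hω.2.2, hH,
    MemLp.ae_slice_top hω.1, MemLp.ae_slice_top hω.2.1, MemLp.ae_slice_two hS.memLp_phi₂,
    MemLp.ae_slice_two hS.memLp_grad₂]
    with t ht hess grad₂ eq₂ gradω mH mω mgω mφ₂ mg₂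
  have ht' := Ioo_subset_Icc_self ht
  have mg₁ := (hS.memLp_slice t ht').2
  have key := elliptic_slice (θ := ωh t) (f := φ₁ t) (h := φ₂ t) (W := fun i x => gω t x i)
    (g := fun i x => g₁ t x i) (k := fun i x => g₂ t x i) (H := fun i j x => H₁ t x i j)
    (M := (eLpNorm (ωh t) ⊤ volume).toReal)
    gradω (hS.grad₁ t ht') (fun i j => hess i j) grad₂ mω (fun i => MemLp.apply_E2 mgω i)
    (hS.memLp_slice t ht').1 (fun i => MemLp.apply_E2 mg₁ i) mH mφ₂ (fun i => MemLp.apply_E2 mg₂ i)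
    (ae_norm_le_toReal_eLpNorm_top mω) (fun ψ hψ => by
      have := sub_eq_zero.1 (eq₂ ψ hψ)
      rw [this]
      congr 1; ext x
      rw [E2.inner_rotOf])
  refine ⟨key.1, ?_⟩
  rw [eLpNorm_two_eq_ofReal_sqrt mg₂, eLpNorm_two_eq_ofReal_sqrt mg₁,
    ← ENNReal.ofReal_toReal mω.2.ne, ← ENNReal.ofReal_mul ENNReal.toReal_nonneg]
  simp only [E2.norm_sq]
  exact ENNReal.ofReal_le_ofReal key.2

/-- The energy estimate for a fixed splitting `u = v + (u - v)` with `σ⁺(Λ) ≤ σ` almost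
everywhere. -/
theorem IsDualSolution.energy_le (hS : IsDualSolution ν T u gω ξ φ₁ w g₁ H₁ φ₂ g₂) (hν : 0 < ν)
    (hω : MemLinftyW1 T ωh gω) (hξ : HasWeakGrad ξ gξ) (mξ : MemLp gξ 2)
    {v : ℝ → Torus → E2} {D : ℝ → Torus → Matrix (Fin 2) (Fin 2) ℝ} (hv : MemLinftyW1Vec T v D)
    {σ : ℝ} (hσ : 0 ≤ σ)
    (hσΛ : ∀ᵐ p ∂(slab T), sigmaPlus (Lam ν (D p.1 p.2) (u p.1 p.2 - v p.1 p.2)) ≤ σ)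
    {s : ℝ} (hs : s ∈ Icc 0 T) :
    (∫ x, ‖g₁ s x‖ ^ 2) + ν * (∫ r in s..T, ∫ x, (H₁ r x 0 0 + H₁ r x 1 1) ^ 2)
      ≤ Real.exp (2 * σ * (T - s)) * ∫ x, ‖gξ x‖ ^ 2 := by
  have hT : T ∈ Icc 0 T := ⟨hs.1.trans hs.2, le_rfl⟩
  have hH : ∀ᵐ t ∂(volume.restrict (Ioo 0 T)), ∀ i j, MemLp (fun x => H₁ t x i j) 2 :=
    ae_all_iff.2 fun i => ae_all_iff.2 fun j =>
      MemLp.ae_slice_two (f := fun t x => H₁ t x i j) (hS.memLp_hess₁ i j)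
  have hvtop : ∀ᵐ t ∂(volume.restrict (Ioo 0 T)), ∀ i, MemLp (fun x => v t x i) ⊤ :=
    ae_all_iff.2 fun i => MemLp.ae_slice_top (hv i).1
  have hDtop : ∀ᵐ t ∂(volume.restrict (Ioo 0 T)), ∀ i j, MemLp (fun x => D t x i j) ⊤ :=
    ae_all_iff.2 fun i => by
      filter_upwards [MemLp.ae_slice_top (hv i).2.1] with t ht j
      exact MemLp.apply_E2 ht j
  have hvgrad : ∀ᵐ t ∂(volume.restrict (Ioo 0 T)), ∀ i,
      HasWeakGrad (fun x => v t x i) (fun x => WithLp.toLp 2 (D t x i)) :=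
    ae_all_iff.2 fun i => (hv i).2.2
  have heq : ∀ᵐ t ∂(volume.restrict (Ioo 0 T)), ∀ᵐ x,
      - w t x - inner ℝ (u t x) (g₁ t x) - φ₂ t x - ν * (H₁ t x).trace = 0 :=
    Measure.ae_ae_of_ae_prod hS.eq₁
  have hΛ : ∀ᵐ t ∂(volume.restrict (Ioo 0 T)), ∀ᵐ x,
      sigmaPlus (Lam ν (D t x) (u t x - v t x)) ≤ σ := Measure.ae_ae_of_ae_prod hσΛ
  set y : ℝ → ℝ := fun t => ∫ x, (g₁ t x 0 ^ 2 + g₁ t x 1 ^ 2) with hy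
  set d : ℝ → ℝ := fun t => ∫ x, (H₁ t x 0 0 + H₁ t x 1 1) ^ 2 with hd
  set B : ℝ → ℝ := fun t => ∫ x, w t x * (H₁ t x 0 0 + H₁ t x 1 1) with hB
  have hBle : ∀ᵐ t ∂(volume.restrict (Ioo 0 T)), B t ≤ σ * y t - ν / 2 * d t := by
    filter_upwards [ae_restrict_mem measurableSet_Ioo, hS.hess₁, hS.grad₂, hH, hvtop, hDtop, hvgrad,
      heq, hΛ, MemLp.ae_slice_two hS.memLp_phi₂, MemLp.ae_slice_two hS.memLp_grad₂,
      MemLp.ae_slice_two hS.memLp_dt, hS.ae_elliptic hω]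
      with t ht hess grad₂ mH mv mD gradv heq hΛ mφ₂ mg₂ mw ell
    have ht' := Ioo_subset_Icc_self ht
    have mg₁ := (hS.memLp_slice t ht').2
    refine integral_dt_mul_lap_le (f := φ₁ t) (h := φ₂ t) (w := w t) (u := fun i x => u t x i)
      (v := fun i x => v t x i) (g := fun i x => g₁ t x i) (k := fun i x => g₂ t x i)
      (D := fun i j x => D t x i j) (H := fun i j x => H₁ t x i j) hν (fun i j => gradv i j)
      (hS.grad₁ t ht') (fun i j => hess i j) grad₂ mv mD (fun i => MemLp.apply_E2 mg₁ i) mH mφ₂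
      (fun i => MemLp.apply_E2 mg₂ i) mw ell.1 ?_ ?_
    · filter_upwards [heq] with x hx
      rw [E2.inner_eq, Matrix.trace_fin_two] at hx
      exact hx
    · filter_upwards [hΛ] with x hx
      refine (Lam_quadForm_le ν (D t x) (u t x - v t x) (g₁ t x 0) (g₁ t x 1)).trans ?_
      exact mul_le_mul_of_nonneg_right hx (by positivity)
  have hident : ∀ t ∈ Icc 0 T, y T - y t = ∫ r in t..T, -2 * B r := by
    intro t ht
    refine energy_identity (φ := φ₁) (w := w) (g := fun i t x => g₁ t x i)
      (H := fun i j t x => H₁ t x i j) hS.memLp_dt hS.memLp_lap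
      (fun t ht => (hS.memLp_slice t ht).1) (fun t ht i => MemLp.apply_E2 (hS.memLp_slice t ht).2 i)
      hS.grad₁ ?_ (MemLp.ae_slice_two hS.memLp_dt) (MemLp.ae_slice_two hS.memLp_lap) hH hS.dt ht
    filter_upwards [hS.hess₁] with t ht i j using ht i j
  have iB0 : Integrable (Function.uncurry fun t x => w t x * (H₁ t x 0 0 + H₁ t x 1 1)) (slab T) :=
    hS.memLp_dt.integrable_mul hS.memLp_lap
  have iB : Integrable B (volume.restrict (Ioo 0 T)) := iB0.integral_prod_left
  have id : Integrable d (volume.restrict (Ioo 0 T)) := hS.memLp_lap.integrable_sq.integral_prod_left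
  have ycont : ContinuousOn y (Icc 0 T) := by
    have h1 := intervalIntegral.continuousOn_primitive_interval'
      (intervalIntegrable_of_restrict_Ioo (iB.const_mul (-2)) hT ⟨le_rfl, hT.1⟩)
      (left_mem_uIcc : T ∈ uIcc T 0)
    rw [uIcc_of_ge hT.1] at h1
    refine ((continuousOn_const (c := y T)).add h1).congr fun t ht => ?_
    have := hident t ht
    rw [intervalIntegral.integral_symm] at this
    rw [Pi.add_apply]
    linarith
  have iy : ∀ t ∈ Icc 0 T, IntervalIntegrable y volume t T := fun t ht =>
    (ycont.mono (Icc_subset_Icc_left ht.1)).intervalIntegrable_of_Icc ht.2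
  have hmain : ∀ t ∈ Icc 0 T, y t + ν * (∫ r in t..T, d r) ≤ y T + 2 * σ * ∫ r in t..T, y r := by
    intro t ht
    have i1 := intervalIntegrable_of_restrict_Ioo (iB.const_mul (-2)) ht hT
    have i2 := intervalIntegrable_of_restrict_Ioo id ht hT
    have h1 : ∫ r in t..T, (ν * d r - 2 * σ * y r) ≤ ∫ r in t..T, -2 * B r := by
      refine intervalIntegral.integral_mono_ae_restrict ht.2
        ((i2.const_mul ν).sub ((iy t ht).const_mul (2 * σ))) i1 ?_
      have h2 : ∀ᵐ r ∂(volume.restrict (Icc 0 T)), B r ≤ σ * y r - ν / 2 * d r := by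
        rwa [← Measure.restrict_congr_set Ioo_ae_eq_Icc]
      filter_upwards [ae_mono (Measure.restrict_mono (Icc_subset_Icc_left ht.1) le_rfl) h2] with r hr
      linarith
    rw [← hident t ht, intervalIntegral.integral_sub (i2.const_mul ν) ((iy t ht).const_mul (2 * σ)),
      intervalIntegral.integral_const_mul, intervalIntegral.integral_const_mul] at h1
    linarith
  have dnn : ∀ t ∈ Icc 0 T, 0 ≤ ν * ∫ r in t..T, d r := fun t ht =>
    mul_nonneg hν.le (intervalIntegral.integral_nonneg ht.2 fun r _ => integral_nonneg fun x => sq_nonneg _)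
  have hyT : y T = ∫ x, ‖gξ x‖ ^ 2 := by
    have hae : ∀ i : Fin 2, (fun x => g₁ T x i) =ᵐ[volume] fun x => gξ x i := fun i =>
      (hS.grad₁ T hT i).ae_unique (hξ i) hS.terminal (MemLp.apply_E2 (hS.memLp_slice T hT).2 i)
        (MemLp.apply_E2 mξ i)
    refine integral_congr_ae ?_
    filter_upwards [hae 0, hae 1] with x h0 h1
    rw [E2.norm_sq, h0, h1]
  have := gronwall_backward hσ hs ycont
    (fun t ht => by linarith [hmain t ht, dnn t ht]) (hmain s hs)
  rw [hyT] at this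
  simp only [E2.norm_sq] at this ⊢
  exact this

theorem eLpNorm_top_le_ofReal {α E : Type*} [MeasurableSpace α] {μ : Measure α}
    [NormedAddCommGroup E] {f : α → E} {C : ℝ} (h : ∀ᵐ x ∂μ, ‖f x‖ ≤ C) :
    eLpNorm f ⊤ μ ≤ ENNReal.ofReal C := by
  rw [eLpNorm_exponent_top]
  exact eLpNormEssSup_le_of_ae_bound h

theorem ae_norm_le_of_eLpNorm_top_le {α E : Type*} [MeasurableSpace α] {μ : Measure α}
    [NormedAddCommGroup E] {f : α → E} {C : ℝ} (hC : 0 ≤ C) (h : eLpNorm f ⊤ μ ≤ ENNReal.ofReal C) :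
    ∀ᵐ x ∂μ, ‖f x‖ ≤ C := by
  have h1 := ae_le_eLpNormEssSup (f := f) (μ := μ)
  filter_upwards [h1] with x hx
  rw [← eLpNorm_exponent_top] at hx
  have := hx.trans h
  rwa [← ofReal_norm, ENNReal.ofReal_le_ofReal_iff hC] at this

theorem hasWeakPartial_zero (i : Fin 2) : HasWeakPartial i (fun _ => 0) (fun _ => 0) :=
  ⟨integrable_zero _ _ _, integrable_zero _ _ _, fun ψ _ => by simp⟩

/-- The flow rate is finite: take `ū = 0`. -/
theorem flowRate_ne_top (hν : 0 < ν) (mu : MemLp (Function.uncurry u) ⊤ (slab T)) :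
    flowRate ν T u ≠ ⊤ := by
  set M := (eLpNorm (Function.uncurry u) ⊤ (slab T)).toReal
  have h0 : MemLinftyW1Vec T (fun _ _ => 0) (fun _ _ => 0) := by
    intro i
    refine ⟨memLp_const _, memLp_const _, .of_forall fun t j => ?_⟩
    exact hasWeakPartial_zero j
  have h1 : eLpNorm (fun p : ℝ × Torus => sigmaPlus (Lam ν 0 (u p.1 p.2 - 0))) ⊤ (slab T)
      ≤ ENNReal.ofReal (6 * (M ^ 2 / ν)) := by
    refine eLpNorm_top_le_ofReal ?_
    filter_upwards [ae_norm_le_toReal_eLpNorm_top mu] with p hp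
    rw [Real.norm_of_nonneg (sigmaPlus_nonneg _)]
    refine sigmaPlus_Lam_le hν (fun i j => ?_) ?_
    · simp only [Matrix.zero_apply, abs_zero]; positivity
    · rw [sub_zero, div_mul_cancel₀ _ hν.ne']
      exact pow_le_pow_left₀ (norm_nonneg _) hp 2
  have h2 : flowRate ν T u ≤ ENNReal.ofReal (6 * (M ^ 2 / ν)) := by
    unfold flowRate
    exact iInf_le_of_le (fun _ _ => 0) (iInf_le_of_le (fun _ _ => 0) (iInf_le_of_le h0 h1))
  exact (h2.trans_lt ENNReal.ofReal_lt_top).ne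

theorem growth_eq (hT : 0 < T) (h : flowRate ν T u ≠ ⊤) :
    growth ν T u = ENNReal.ofReal (Real.exp (T * (flowRate ν T u).toReal)) := by
  have e : ENNReal.ofReal T / flowTime ν T u
      = ENNReal.ofReal (T * (flowRate ν T u).toReal) := by
    rw [flowTime, div_eq_mul_inv, inv_inv, ENNReal.ofReal_mul hT.le, ENNReal.ofReal_toReal h]
  rw [growth, e, EReal.coe_ennreal_ofReal, max_eq_left (by positivity), EReal.exp_coe]

/-- The energy estimate with the optimal rate, obtained by approaching the infimum. -/
theorem IsDualSolution.energy_le_flowRate (hS : IsDualSolution ν T u gω ξ φ₁ w g₁ H₁ φ₂ g₂)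
    (hν : 0 < ν) (mu : MemLp (Function.uncurry u) ⊤ (slab T)) (hω : MemLinftyW1 T ωh gω)
    (hξ : HasWeakGrad ξ gξ) (mξ : MemLp gξ 2) {s : ℝ} (hs : s ∈ Icc 0 T) :
    (∫ x, ‖g₁ s x‖ ^ 2) + ν * (∫ r in s..T, ∫ x, (H₁ r x 0 0 + H₁ r x 1 1) ^ 2)
      ≤ Real.exp (2 * (flowRate ν T u).toReal * (T - s)) * ∫ x, ‖gξ x‖ ^ 2 := by
  have hfin := flowRate_ne_top hν mu
  set r₀ := (flowRate ν T u).toReal with hr₀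
  have hr0 : 0 ≤ r₀ := ENNReal.toReal_nonneg
  have key : ∀ σ ∈ Ioi r₀, (∫ x, ‖g₁ s x‖ ^ 2)
      + ν * (∫ r in s..T, ∫ x, (H₁ r x 0 0 + H₁ r x 1 1) ^ 2)
      ≤ Real.exp (2 * σ * (T - s)) * ∫ x, ‖gξ x‖ ^ 2 := by
    intro σ hσ
    have hσ0 : 0 ≤ σ := hr0.trans (le_of_lt hσ)
    have hlt : flowRate ν T u < ENNReal.ofReal σ := by
      rw [← ENNReal.ofReal_toReal hfin]
      exact (ENNReal.ofReal_lt_ofReal_iff (hr0.trans_lt hσ)).2 hσ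
    unfold flowRate at hlt
    simp only [iInf_lt_iff] at hlt
    obtain ⟨v, D, hv, hlt⟩ := hlt
    refine hS.energy_le hν hω hξ mξ hv hσ0 ?_ hs
    filter_upwards [ae_norm_le_of_eLpNorm_top_le hσ0 hlt.le] with p hp
    exact (le_abs_self _).trans hp
  have hcont : Tendsto (fun σ => Real.exp (2 * σ * (T - s)) * ∫ x, ‖gξ x‖ ^ 2) (𝓝[>] r₀)
      (𝓝 (Real.exp (2 * r₀ * (T - s)) * ∫ x, ‖gξ x‖ ^ 2)) := by
    refine Tendsto.mono_left (Continuous.tendsto ?_ _) nhdsWithin_le_nhds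
    fun_prop
  exact ge_of_tendsto hcont (by filter_upwards [self_mem_nhdsWithin] with σ hσ using key σ hσ)

theorem IsDualSolution.eLpNorm_grad_le (hS : IsDualSolution ν T u gω ξ φ₁ w g₁ H₁ φ₂ g₂)
    (hν : 0 < ν) (hT : 0 < T) (mu : MemLp (Function.uncurry u) ⊤ (slab T))
    (hω : MemLinftyW1 T ωh gω) (hξ : HasWeakGrad ξ gξ) (mξ : MemLp gξ 2) {s : ℝ} (hs : s ∈ Icc 0 T) :
    eLpNorm (g₁ s) 2 volume ≤ growth ν T u * eLpNorm gξ 2 volume := by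
  have h := hS.energy_le_flowRate hν mu hω hξ mξ hs
  have hr0 : 0 ≤ (flowRate ν T u).toReal := ENNReal.toReal_nonneg
  have hd : 0 ≤ ν * ∫ r in s..T, ∫ x, (H₁ r x 0 0 + H₁ r x 1 1) ^ 2 :=
    mul_nonneg hν.le (intervalIntegral.integral_nonneg hs.2 fun r _ =>
      integral_nonneg fun x => sq_nonneg _)
  have hI : 0 ≤ ∫ x, ‖gξ x‖ ^ 2 := integral_nonneg fun x => by positivity
  rw [growth_eq hT (flowRate_ne_top hν mu), eLpNorm_two_eq_ofReal_sqrt (hS.memLp_slice s hs).2,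
    eLpNorm_two_eq_ofReal_sqrt mξ, ← ENNReal.ofReal_mul (Real.exp_pos _).le]
  refine ENNReal.ofReal_le_ofReal (Real.sqrt_le_iff.2 ⟨by positivity, ?_⟩)
  rw [mul_pow, Real.sq_sqrt hI, ← Real.exp_nat_mul]
  have : Real.exp (2 * (flowRate ν T u).toReal * (T - s))
      ≤ Real.exp ((2 : ℕ) * (T * (flowRate ν T u).toReal)) := by
    refine Real.exp_le_exp.2 ?_
    push_cast
    nlinarith [mul_nonneg hr0 hs.1]
  nlinarith

/-- The norm of the whole Hessian over space-time is that of the Laplacian. -/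
theorem IsDualSolution.eLpNorm_hess_le (hS : IsDualSolution ν T u gω ξ φ₁ w g₁ H₁ φ₂ g₂)
    (hν : 0 < ν) (hT : 0 < T) (mu : MemLp (Function.uncurry u) ⊤ (slab T))
    (hω : MemLinftyW1 T ωh gω) (hξ : HasWeakGrad ξ gξ) (mξ : MemLp gξ 2) :
    ENNReal.ofReal (Real.sqrt ν) * eLpNorm (fun p : ℝ × Torus =>
        Real.sqrt (∑ i : Fin 2, ∑ j : Fin 2, H₁ p.1 p.2 i j ^ 2)) 2 (slab T)
      ≤ growth ν T u * eLpNorm gξ 2 volume := by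
  have h0 : (0 : ℝ) ∈ Icc 0 T := ⟨le_rfl, hT.le⟩
  have h := hS.energy_le_flowRate hν mu hω hξ mξ h0
  have hsum : ∀ i j, Integrable (fun p : ℝ × Torus => H₁ p.1 p.2 i j ^ 2) (slab T) :=
    fun i j => (hS.memLp_hess₁ i j).integrable_sq
  have hint : Integrable (fun p : ℝ × Torus => ∑ i : Fin 2, ∑ j : Fin 2, H₁ p.1 p.2 i j ^ 2)
      (slab T) := integrable_finsetSum _ fun i _ => integrable_finsetSum _ fun j _ => hsum i j
  have hnn : ∀ p : ℝ × Torus, 0 ≤ ∑ i : Fin 2, ∑ j : Fin 2, H₁ p.1 p.2 i j ^ 2 := fun p =>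
    Finset.sum_nonneg fun i _ => Finset.sum_nonneg fun j _ => sq_nonneg _
  have mS : MemLp (fun p : ℝ × Torus =>
      Real.sqrt (∑ i : Fin 2, ∑ j : Fin 2, H₁ p.1 p.2 i j ^ 2)) 2 (slab T) := by
    rw [memLp_two_iff_integrable_sq hint.1.aemeasurable.sqrt.aestronglyMeasurable]
    simpa only [Real.sq_sqrt (hnn _)] using hint
  have hH : ∀ᵐ t ∂(volume.restrict (Ioo 0 T)), ∀ i j, MemLp (fun x => H₁ t x i j) 2 :=
    ae_all_iff.2 fun i => ae_all_iff.2 fun j =>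
      MemLp.ae_slice_two (f := fun t x => H₁ t x i j) (hS.memLp_hess₁ i j)
  have hsq : ∫ p, ‖Real.sqrt (∑ i : Fin 2, ∑ j : Fin 2, H₁ p.1 p.2 i j ^ 2)‖ ^ 2 ∂(slab T)
      = ∫ r in (0 : ℝ)..T, ∫ x, (H₁ r x 0 0 + H₁ r x 1 1) ^ 2 := by
    simp only [Real.norm_eq_abs, sq_abs, Real.sq_sqrt (hnn _)]
    rw [intervalIntegral.integral_of_le hT.le, ← Measure.restrict_congr_set Ioo_ae_eq_Ioc]
    unfold slab at hint ⊢
    rw [integral_prod _ hint]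
    refine integral_congr_ae ?_
    filter_upwards [ae_restrict_mem measurableSet_Ioo, hS.hess₁, hH] with t ht hess mH
    exact integral_hess_sq_eq_integral_lap_sq (f := φ₁ t) (g := fun i x => g₁ t x i)
      (H := fun i j x => H₁ t x i j) (hS.grad₁ t (Ioo_subset_Icc_self ht))
      (fun i j => hess i j) mH
  have hI : 0 ≤ ∫ x, ‖gξ x‖ ^ 2 := integral_nonneg fun x => by positivity
  have hJ : 0 ≤ ∫ x, ‖g₁ 0 x‖ ^ 2 := integral_nonneg fun x => by positivity
  rw [growth_eq hT (flowRate_ne_top hν mu), eLpNorm_two_eq_ofReal_sqrt mS, hsq,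
    eLpNorm_two_eq_ofReal_sqrt mξ, ← ENNReal.ofReal_mul (Real.exp_pos _).le,
    ← ENNReal.ofReal_mul (Real.sqrt_nonneg _), ← Real.sqrt_mul hν.le]
  refine ENNReal.ofReal_le_ofReal (Real.sqrt_le_iff.2 ⟨by positivity, ?_⟩)
  rw [mul_pow, Real.sq_sqrt hI, ← Real.exp_nat_mul]
  have e : 2 * (flowRate ν T u).toReal * (T - 0) = (2 : ℕ) * (T * (flowRate ν T u).toReal) := by
    push_cast; ring
  rw [e] at h
  linarith

theorem IsDualSolution.stability (hS : IsDualSolution ν T u gω ξ φ₁ w g₁ H₁ φ₂ g₂)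
    (hν : 0 < ν) (hT : 0 < T) (mu : MemLp (Function.uncurry u) ⊤ (slab T))
    (hω : MemLinftyW1 T ωh gω) (hξ : HasWeakGrad ξ gξ) (mξ : MemLp gξ 2) :
    ((⨆ t ∈ Ioo 0 T, eLpNorm (g₁ t) 2 volume)
        + ENNReal.ofReal (Real.sqrt ν) * eLpNorm (fun p : ℝ × Torus =>
            Real.sqrt (∑ i : Fin 2, ∑ j : Fin 2, H₁ p.1 p.2 i j ^ 2)) 2 (slab T)
      ≤ ENNReal.ofReal 2 * growth ν T u * eLpNorm gξ 2 volume) ∧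
    ((∫⁻ t in Ioo 0 T, eLpNorm (g₂ t) 2 volume)
      ≤ growth ν T u * (∫⁻ t in Ioo 0 T, eLpNorm (ωh t) ⊤ volume) * eLpNorm gξ 2 volume) := by
  constructor
  · rw [ENNReal.ofReal_ofNat, mul_assoc, two_mul]
    refine add_le_add (iSup₂_le fun t ht => ?_) (hS.eLpNorm_hess_le hν hT mu hω hξ mξ)
    exact hS.eLpNorm_grad_le hν hT mu hω hξ mξ (Ioo_subset_Icc_self ht)
  · have hfin : growth ν T u * eLpNorm gξ 2 volume ≠ ⊤ := by
      rw [growth_eq hT (flowRate_ne_top hν mu)]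
      exact ENNReal.mul_ne_top ENNReal.ofReal_ne_top mξ.2.ne
    rw [mul_right_comm, ← lintegral_const_mul' _ _ hfin]
    refine lintegral_mono_ae ?_
    filter_upwards [ae_restrict_mem measurableSet_Ioo, hS.ae_elliptic hω] with t ht ell
    rw [mul_comm]
    exact ell.2.trans (mul_le_mul_right (hS.eLpNorm_grad_le hν hT mu hω hξ mξ
      (Ioo_subset_Icc_self ht)) _)

end

/-! ### A uniform Korn inequality -/

/-- The covering map from the plane to the torus. -/
def toT (y : Fin 2 → ℝ) : Torus := fun i => (y i : UnitAddCircle)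

theorem continuous_toT : Continuous toT :=
  continuous_pi fun i => (AddCircle.continuous_mk' 1).comp (continuous_apply i)

theorem toT_add (y z : Fin 2 → ℝ) : toT (y + z) = toT y + toT z := by
  ext i; simp [toT]

/-- The chain rule along a curve, for smooth functions on the torus. -/
theorem IsTest.hasDerivAt_curve {F : Torus → ℝ} (hF : IsTest F) (x : Torus) {c : ℝ → Fin 2 → ℝ}
    {c' : Fin 2 → ℝ} {s : ℝ} (hc : HasDerivAt c c' s) :
    HasDerivAt (fun s => F (x + toT (c s)))
      (c' 0 * pd 0 F (x + toT (c s)) + c' 1 * pd 1 F (x + toT (c s))) s := by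
  obtain ⟨y, hy⟩ := exists_lift x
  have hy' : toT y = x := hy
  set G : (Fin 2 → ℝ) → ℝ := fun z => F (toT z) with hG
  have hGd : Differentiable ℝ G := hF.differentiable (by simp)
  have hpd : ∀ (i : Fin 2) (z : Fin 2 → ℝ), pd i F (toT z) = fderiv ℝ G z (Pi.single i 1) := by
    intro i z
    refine HasDerivAt.deriv ?_
    have h1 : HasDerivAt (fun s : ℝ => z + s • (Pi.single i 1 : Fin 2 → ℝ)) (Pi.single i 1) 0 := by
      simpa using ((hasDerivAt_id (0 : ℝ)).smul_const (Pi.single i 1 : Fin 2 → ℝ)).const_add z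
    have h2 : HasFDerivAt G (fderiv ℝ G z) (z + (0 : ℝ) • (Pi.single i 1 : Fin 2 → ℝ)) := by
      rw [zero_smul, add_zero]; exact (hGd z).hasFDerivAt
    refine (h2.comp_hasDerivAt (0 : ℝ) h1).congr_of_eventuallyEq (.of_forall fun s => ?_)
    show F (toT z + _) = F (toT _)
    congr 1
    exact lift_add_single z i s
  have key := (hGd (y + c s)).hasFDerivAt.comp_hasDerivAt s (hc.const_add y)
  have e : ∀ s, x + toT (c s) = toT (y + c s) := fun s => by rw [toT_add, hy']
  simp only [e, hpd]
  refine key.congr_deriv ?_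
  have hc' : c' = c' 0 • (Pi.single 0 1 : Fin 2 → ℝ) + c' 1 • (Pi.single 1 1 : Fin 2 → ℝ) := by
    ext i; fin_cases i <;> simp
  conv_lhs => rw [hc']
  simp [map_add, map_smul]

/-- Polar coordinates, as a map from `(r, θ)` to the torus. -/
noncomputable def polarT (z : ℝ × ℝ) : Torus := toT ![z.1 * Real.cos z.2, z.1 * Real.sin z.2]

theorem continuous_polarT : Continuous polarT := by
  refine continuous_toT.comp (continuous_pi fun i => ?_)
  fin_cases i <;> simp <;> fun_prop

/-- The coordinate box `0 < r < 1/2`, `-π < θ < π`. -/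
noncomputable def polarBox : Measure (ℝ × ℝ) :=
  (volume.restrict (Ioo 0 (1 / 2))).prod (volume.restrict (Ioo (-Real.pi) Real.pi))

instance : IsFiniteMeasure polarBox := by unfold polarBox; infer_instance

theorem polarBox_eq_restrict :
    polarBox = volume.restrict (Ioo 0 (1 / 2) ×ˢ Ioo (-Real.pi) Real.pi) := by
  rw [polarBox, Measure.prod_restrict, Measure.volume_eq_prod]

theorem polarBox_real_univ : polarBox.real univ = Real.pi := by
  rw [polarBox, ← univ_prod_univ, measureReal_prod_prod]
  simp [Real.volume_real_Ioo_of_le (show (-Real.pi) ≤ Real.pi by linarith [Real.pi_pos])]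
  ring

theorem lintegral_eq_lintegral_Ioc_of_eq_pi_haar (μ : Measure Torus)
    (hμ : μ = Measure.pi fun _ : Fin 2 => AddCircle.haarAddCircle) (f : Torus → ℝ≥0∞)
    (a : Fin 2 → ℝ) :
    ∫⁻ x, f x ∂μ = ∫⁻ y in {y : Fin 2 → ℝ | ∀ i, y i ∈ Ioc (a i) (a i + 1)}, f (toT y) := by
  subst hμ
  exact UnitAddTorus.lintegral_preimage f a

/-- The disc of radius `1/2` embeds in the torus. -/
theorem lintegral_polarBox_le (G : Torus → ℝ≥0∞) (x : Torus) :
    ∫⁻ z, ENNReal.ofReal z.1 * G (x + polarT z) ∂polarBox ≤ ∫⁻ y, G y := by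
  set S : Set (Fin 2 → ℝ) := {y : Fin 2 → ℝ | ∀ i, y i ∈ Ioc (-1 / 2 : ℝ) (-1 / 2 + 1)} with hS
  have hSm : MeasurableSet S := by
    have : S = univ.pi fun _ => Ioc (-1 / 2 : ℝ) (-1 / 2 + 1) := by ext; simp [hS]
    rw [this]; exact MeasurableSet.univ_pi fun _ => measurableSet_Ioc
  set f : (Fin 2 → ℝ) → ℝ≥0∞ := S.indicator fun y => G (x + toT y) with hf
  have h1 : ∫⁻ y, G y = ∫⁻ y, f y := by
    rw [← lintegral_add_left_eq_self G x, lintegral_eq_lintegral_Ioc_of_eq_pi_haar volume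
      volume_torus_eq_pi_haar _ (fun _ => -1 / 2), hf, lintegral_indicator hSm]
  have h2 : ∫⁻ y, f y = ∫⁻ q : ℝ × ℝ, f ![q.1, q.2] :=
    ((volume_preserving_finTwoArrow ℝ).symm.lintegral_comp_emb
      (MeasurableEquiv.measurableEmbedding _) f).symm
  rw [h1, h2, ← lintegral_comp_polarCoord_symm, polarBox_eq_restrict]
  refine le_trans (le_of_eq ?_) (lintegral_mono_set (s := Ioo 0 (1 / 2) ×ˢ Ioo (-Real.pi) Real.pi) ?_)
  · refine setLIntegral_congr_fun (measurableSet_Ioo.prod measurableSet_Ioo) fun z hz => ?_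
    have hz0 := hz.1.1
    have hz1 := hz.1.2
    have hmem : (![z.1 * Real.cos z.2, z.1 * Real.sin z.2] : Fin 2 → ℝ) ∈ S := by
      have hc := abs_le.1 (Real.abs_cos_le_one z.2)
      have hs := abs_le.1 (Real.abs_sin_le_one z.2)
      intro i
      fin_cases i
      · exact ⟨by simp; nlinarith, by simp; nlinarith⟩
      · exact ⟨by simp; nlinarith, by simp; nlinarith⟩
    simp only [polarCoord_symm_apply, hf, indicator_of_mem hmem, smul_eq_mul, polarT]
  · intro z hz
    rw [polarCoord_target]
    exact ⟨hz.1.1, hz.2⟩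

theorem integral_polarBox_le {F : Torus → ℝ} (hF : Continuous F) (x : Torus) :
    ∫ z, z.1 * |F (x + polarT z)| ∂polarBox ≤ ∫ y, |F y| := by
  rw [integral_eq_lintegral_of_nonneg_ae, integral_eq_lintegral_of_nonneg_ae
    (.of_forall fun _ => abs_nonneg _) (by fun_prop)]
  · refine ENNReal.toReal_mono ?_ ?_
    · have : Integrable (fun y => |F y|) :=
        ((BoundedContinuousFunction.mkOfCompact ⟨F, hF⟩).memLp_top.mono_exponent
          (p := 1) le_top).integrable le_rfl |>.abs
      exact (hasFiniteIntegral_iff_ofReal (.of_forall fun _ => abs_nonneg _)).1 this.2 |>.ne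
    · refine le_trans (le_of_eq ?_) (lintegral_polarBox_le (fun y => ENNReal.ofReal |F y|) x)
      refine lintegral_congr_ae ?_
      rw [polarBox_eq_restrict]
      filter_upwards [ae_restrict_mem (measurableSet_Ioo.prod measurableSet_Ioo)] with z hz
      exact ENNReal.ofReal_mul hz.1.1.le
  · rw [polarBox_eq_restrict]
    filter_upwards [ae_restrict_mem (measurableSet_Ioo.prod measurableSet_Ioo)] with z hz
    exact mul_nonneg hz.1.1.le (abs_nonneg _)
  · have := continuous_polarT
    exact Continuous.aestronglyMeasurable (by fun_prop)

theorem continuous_polarT_comp {F : Torus → ℝ} (hF : Continuous F) (x : Torus) :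
    Continuous fun z : ℝ × ℝ => F (x + polarT z) :=
  hF.comp (continuous_const.add continuous_polarT)

theorem integrable_polarBox {f : ℝ × ℝ → ℝ} (hf : Continuous f) : Integrable f polarBox := by
  rw [polarBox_eq_restrict]
  refine IntegrableOn.mono_set (hf.continuousOn.integrableOn_compact
    (isCompact_Icc.prod isCompact_Icc)) (Set.prod_mono Ioo_subset_Icc_self Ioo_subset_Icc_self)

theorem integral_polarBox {f : ℝ × ℝ → ℝ} (hf : Continuous f) :
    ∫ z, f z ∂polarBox = ∫ r in (0 : ℝ)..(1 / 2), ∫ θ in (-Real.pi)..Real.pi, f (r, θ) := by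
  have h := integrable_polarBox hf
  rw [polarBox] at h ⊢
  rw [integral_prod _ h, intervalIntegral.integral_of_le (by norm_num),
    ← Measure.restrict_congr_set Ioo_ae_eq_Ioc]
  congr 1; ext r
  rw [intervalIntegral.integral_of_le (by linarith [Real.pi_pos]),
    ← Measure.restrict_congr_set Ioo_ae_eq_Ioc]

/-- Comparison of a function with its circle averages, by the Cauchy-Riemann operator: with
`a = ∂₀F₀ - ∂₁F₁` and `b = ∂₁F₀ + ∂₀F₁`, the radial derivative of `F₀` is
`cos θ a + sin θ b + r⁻¹ ∂_θ F₁`, whose last term averages to zero over circles. -/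
theorem two_pi_mul_abs_le {F₀ F₁ a b : Torus → ℝ} (h₀ : IsTest F₀) (h₁ : IsTest F₁)
    (c₀ : Continuous F₀) (cd₀ : ∀ i, Continuous (pd i F₀)) (cd₁ : ∀ i, Continuous (pd i F₁))
    (ha : ∀ x, a x = pd 0 F₀ x - pd 1 F₁ x) (hb : ∀ x, b x = pd 1 F₀ x + pd 0 F₁ x)
    (x : Torus) {r : ℝ} (hr : r ∈ Icc (0 : ℝ) (1 / 2)) :
    2 * Real.pi * |F₀ x| ≤ (∫ θ in (-Real.pi)..Real.pi, |F₀ (x + polarT (r, θ))|)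
      + ∫ z, (|a (x + polarT z)| + |b (x + polarT z)|) ∂polarBox := by
  have hπ : -Real.pi ≤ Real.pi := by linarith [Real.pi_pos]
  have ca : Continuous a := by
    have : a = fun x => pd 0 F₀ x - pd 1 F₁ x := funext ha
    rw [this]; exact (cd₀ 0).sub (cd₁ 1)
  have cb : Continuous b := by
    have : b = fun x => pd 1 F₀ x + pd 0 F₁ x := funext hb
    rw [this]; exact (cd₀ 1).add (cd₁ 0)
  have C := fun {F : Torus → ℝ} (hF : Continuous F) => continuous_polarT_comp hF x
  have Ca := C ca
  have Cb := C cb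
  have C0 := C c₀
  have C00 := C (cd₀ 0)
  have C01 := C (cd₀ 1)
  have C10 := C (cd₁ 0)
  have C11 := C (cd₁ 1)
  set Q : ℝ × ℝ → ℝ := fun z => Real.cos z.2 * pd 0 F₀ (x + polarT z)
    + Real.sin z.2 * pd 1 F₀ (x + polarT z) with hQ
  set W : ℝ × ℝ → ℝ := fun z => Real.cos z.2 * a (x + polarT z)
    + Real.sin z.2 * b (x + polarT z) with hW
  have cQ : Continuous Q := by fun_prop
  have cW : Continuous W := ((Real.continuous_cos.comp continuous_snd).mul Ca).add
    ((Real.continuous_sin.comp continuous_snd).mul Cb)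
  have slice : ∀ {f : ℝ × ℝ → ℝ}, Continuous f → ∀ ρ, Continuous fun θ => f (ρ, θ) :=
    fun hf ρ => hf.comp (by fun_prop)
  have slice' : ∀ {f : ℝ × ℝ → ℝ}, Continuous f → ∀ θ, Continuous fun ρ => f (ρ, θ) :=
    fun hf ρ => hf.comp (by fun_prop)
  have radial : ∀ θ, ∫ ρ in (0 : ℝ)..r, Q (ρ, θ) = F₀ (x + polarT (r, θ)) - F₀ x := by
    intro θ
    have hd : ∀ ρ, HasDerivAt (fun ρ => F₀ (x + polarT (ρ, θ))) (Q (ρ, θ)) ρ := by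
      intro ρ
      refine h₀.hasDerivAt_curve x (c := fun ρ => ![ρ * Real.cos θ, ρ * Real.sin θ])
        (c' := ![Real.cos θ, Real.sin θ]) ?_
      rw [hasDerivAt_pi]
      intro i
      fin_cases i
      · simpa using (hasDerivAt_id ρ).mul_const (Real.cos θ)
      · simpa using (hasDerivAt_id ρ).mul_const (Real.sin θ)
    rw [intervalIntegral.integral_eq_sub_of_hasDerivAt (fun ρ _ => hd ρ)
      ((slice' cQ θ).intervalIntegrable _ _)]
    have : polarT (0, θ) = 0 := by ext i; fin_cases i <;> simp [polarT, toT]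
    rw [this, add_zero]
  have angular : ∀ ρ ∈ Ioc (0 : ℝ) r, ∫ θ in (-Real.pi)..Real.pi, Q (ρ, θ)
      = ∫ θ in (-Real.pi)..Real.pi, W (ρ, θ) := by
    intro ρ hρ
    set V : ℝ × ℝ → ℝ := fun z => -(z.1 * Real.sin z.2) * pd 0 F₁ (x + polarT z)
      + (z.1 * Real.cos z.2) * pd 1 F₁ (x + polarT z) with hV
    have cV : Continuous V := by fun_prop
    have hd : ∀ θ, HasDerivAt (fun θ => F₁ (x + polarT (ρ, θ))) (V (ρ, θ)) θ := by
      intro θ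
      refine h₁.hasDerivAt_curve x (c := fun θ => ![ρ * Real.cos θ, ρ * Real.sin θ])
        (c' := ![-(ρ * Real.sin θ), ρ * Real.cos θ]) ?_
      rw [hasDerivAt_pi]
      intro i
      fin_cases i
      · simpa using (Real.hasDerivAt_cos θ).const_mul ρ
      · simpa using (Real.hasDerivAt_sin θ).const_mul ρ
    have hV0 : ∫ θ in (-Real.pi)..Real.pi, V (ρ, θ) = 0 := by
      rw [intervalIntegral.integral_eq_sub_of_hasDerivAt (fun θ _ => hd θ)
        ((slice cV ρ).intervalIntegrable _ _)]
      simp [polarT]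
    have e : ∀ θ, Q (ρ, θ) = W (ρ, θ) + ρ⁻¹ * V (ρ, θ) := by
      intro θ
      have := hρ.1.ne'
      simp only [hQ, hW, hV, ha, hb]
      field_simp
      ring
    simp only [e]
    rw [intervalIntegral.integral_add ((slice cW ρ).intervalIntegrable _ _)
      (((slice cV ρ).intervalIntegrable _ _).const_mul _), intervalIntegral.integral_const_mul,
      hV0, mul_zero, add_zero]
  have swap : ∫ θ in (-Real.pi)..Real.pi, ∫ ρ in (0 : ℝ)..r, Q (ρ, θ)
      = ∫ ρ in (0 : ℝ)..r, ∫ θ in (-Real.pi)..Real.pi, Q (ρ, θ) := by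
    refine intervalIntegral_intervalIntegral_swap (F := fun θ ρ => Q (ρ, θ)) ?_
    have : Continuous (Function.uncurry fun θ ρ => Q (ρ, θ)) := cQ.comp (by fun_prop)
    exact (this.continuousOn.integrableOn_compact (isCompact_uIcc.prod isCompact_uIcc)).mono_set
      (Set.prod_mono uIoc_subset_uIcc uIoc_subset_uIcc)
  have average : (∫ θ in (-Real.pi)..Real.pi, F₀ (x + polarT (r, θ))) - 2 * Real.pi * F₀ x
      = ∫ ρ in (0 : ℝ)..r, ∫ θ in (-Real.pi)..Real.pi, W (ρ, θ) := by
    have e1 : ∫ ρ in (0 : ℝ)..r, ∫ θ in (-Real.pi)..Real.pi, W (ρ, θ)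
        = ∫ ρ in (0 : ℝ)..r, ∫ θ in (-Real.pi)..Real.pi, Q (ρ, θ) := by
      refine intervalIntegral.integral_congr_ae (.of_forall fun ρ hρ => ?_)
      rw [uIoc_of_le hr.1] at hρ
      exact (angular ρ hρ).symm
    rw [e1, ← swap]
    simp only [radial]
    rw [intervalIntegral.integral_sub ((slice C0 r).intervalIntegrable _ _)
      intervalIntegrable_const, intervalIntegral.integral_const, smul_eq_mul]
    ring
  have cE : Continuous fun z => |a (x + polarT z)| + |b (x + polarT z)| := Ca.abs.add Cb.abs
  have cE' : Continuous fun ρ => ∫ θ in (-Real.pi)..Real.pi,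
      (|a (x + polarT (ρ, θ))| + |b (x + polarT (ρ, θ))|) :=
    intervalIntegral.continuous_parametric_intervalIntegral_of_continuous' (by
      exact cE.comp (by fun_prop)) _ _
  have remainder : |∫ ρ in (0 : ℝ)..r, ∫ θ in (-Real.pi)..Real.pi, W (ρ, θ)|
      ≤ ∫ z, (|a (x + polarT z)| + |b (x + polarT z)|) ∂polarBox := by
    rw [integral_polarBox cE]
    have hsub : ∫ ρ in (0 : ℝ)..r, ∫ θ in (-Real.pi)..Real.pi,
          (|a (x + polarT (ρ, θ))| + |b (x + polarT (ρ, θ))|)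
        ≤ ∫ ρ in (0 : ℝ)..(1 / 2), ∫ θ in (-Real.pi)..Real.pi,
          (|a (x + polarT (ρ, θ))| + |b (x + polarT (ρ, θ))|) := by
      refine intervalIntegral.integral_mono_interval le_rfl hr.1 hr.2 (.of_forall fun ρ => ?_)
        (cE'.intervalIntegrable _ _)
      exact intervalIntegral.integral_nonneg hπ fun θ _ => by positivity
    refine le_trans ?_ hsub
    rw [← Real.norm_eq_abs]
    refine intervalIntegral.norm_integral_le_of_norm_le hr.1 (.of_forall fun ρ _ => ?_)
      (cE'.intervalIntegrable _ _)
    refine intervalIntegral.norm_integral_le_of_norm_le hπ (.of_forall fun θ _ => ?_)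
      ((slice cE ρ).intervalIntegrable _ _)
    simp only [hW]
    refine (norm_add_le _ _).trans (add_le_add ?_ ?_)
    · rw [norm_mul, Real.norm_eq_abs, Real.norm_eq_abs]
      exact mul_le_of_le_one_left (abs_nonneg _) (Real.abs_cos_le_one _)
    · rw [norm_mul, Real.norm_eq_abs, Real.norm_eq_abs]
      exact mul_le_of_le_one_left (abs_nonneg _) (Real.abs_sin_le_one _)
  have circle : |∫ θ in (-Real.pi)..Real.pi, F₀ (x + polarT (r, θ))|
      ≤ ∫ θ in (-Real.pi)..Real.pi, |F₀ (x + polarT (r, θ))| :=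
    intervalIntegral.abs_integral_le_integral_abs hπ
  rw [← average] at remainder
  have h2 : 2 * Real.pi * |F₀ x| = |2 * Real.pi * F₀ x| := by
    rw [abs_mul, abs_of_pos (by positivity : 0 < 2 * Real.pi)]
  rw [h2]
  have h3 := abs_sub_abs_le_abs_sub (2 * Real.pi * F₀ x)
    (∫ θ in (-Real.pi)..Real.pi, F₀ (x + polarT (r, θ)))
  rw [abs_sub_comm] at h3
  linarith

/-- Averaging the comparison with circle averages over the radii `r < 1/2`, with weight `r dr`, bounds
a function by its mean over a disc and its Cauchy-Riemann operator. -/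
theorem abs_le_integral_add {F₀ F₁ a b : Torus → ℝ} (h₀ : IsTest F₀) (h₁ : IsTest F₁)
    (c₀ : Continuous F₀) (cd₀ : ∀ i, Continuous (pd i F₀)) (cd₁ : ∀ i, Continuous (pd i F₁))
    (ha : ∀ x, a x = pd 0 F₀ x - pd 1 F₁ x) (hb : ∀ x, b x = pd 1 F₀ x + pd 0 F₁ x)
    (x : Torus) :
    |F₀ x| ≤ 2 * (∫ y, |F₀ y|)
      + (∫ z, (|a (x + polarT z)| + |b (x + polarT z)|) ∂polarBox) / (2 * Real.pi) := by
  set E := ∫ z, (|a (x + polarT z)| + |b (x + polarT z)|) ∂polarBox with hE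
  have cP : Continuous fun z => |F₀ (x + polarT z)| := (continuous_polarT_comp c₀ x).abs
  have cP' : Continuous fun z : ℝ × ℝ => z.1 * |F₀ (x + polarT z)| := continuous_fst.mul cP
  have cI : Continuous fun r => ∫ θ in (-Real.pi)..Real.pi, |F₀ (x + polarT (r, θ))| :=
    intervalIntegral.continuous_parametric_intervalIntegral_of_continuous' (by
      exact cP.comp (by fun_prop)) _ _
  have h1 : ∫ r in (0 : ℝ)..(1 / 2), r * (2 * Real.pi * |F₀ x| - E)
      ≤ ∫ r in (0 : ℝ)..(1 / 2), r * ∫ θ in (-Real.pi)..Real.pi, |F₀ (x + polarT (r, θ))| := by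
    refine intervalIntegral.integral_mono_on (by norm_num)
      (Continuous.intervalIntegrable (by fun_prop) _ _)
      (Continuous.intervalIntegrable (by fun_prop) _ _) fun r hr => ?_
    refine mul_le_mul_of_nonneg_left ?_ hr.1
    linarith [two_pi_mul_abs_le h₀ h₁ c₀ cd₀ cd₁ ha hb x hr]
  have h2 := integral_polarBox_le c₀ x
  rw [integral_polarBox cP'] at h2
  simp only [intervalIntegral.integral_const_mul] at h2
  rw [intervalIntegral.integral_mul_const, integral_id] at h1
  have h3 : 2 * Real.pi * |F₀ x| ≤ 8 * (∫ y, |F₀ y|) + E := by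
    norm_num at h1
    linarith
  have hI : 0 ≤ ∫ y, |F₀ y| := integral_nonneg fun _ => abs_nonneg _
  have hπ := Real.pi_gt_three
  rw [← sub_le_iff_le_add', le_div_iff₀ (by positivity)]
  nlinarith

theorem coef_one_eq_zero {k : Fin 2 → ℤ} (hk : k ≠ 0) : coef (fun _ => 1) k = 0 := by
  have h := sum_le_hasSum {0, k} (fun _ _ => by positivity)
    (hasSum_coef_sq (memLp_const (α := Torus) (μ := volume) (1 : ℝ)))
  have h0 : coef (fun _ => 1) 0 = 1 := by simp [coef, mFourier_zero]
  rw [Finset.sum_pair hk.symm, h0] at h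
  simp only [norm_one, one_pow, integral_const, probReal_univ, smul_eq_mul, mul_one] at h
  have : ‖coef (fun _ => 1) k‖ ^ 2 = 0 := le_antisymm (by linarith) (by positivity)
  simpa using this

/-- On mean-zero Fourier modes, the Cauchy-Riemann operator controls the `L²` norm. -/
theorem integral_sq_sub_mean_le {v₀ v₁ d₀₀ d₀₁ d₁₀ d₁₁ : Torus → ℝ}
    (h₀₀ : HasWeakPartial 0 v₀ d₀₀) (h₀₁ : HasWeakPartial 1 v₀ d₀₁)
    (h₁₀ : HasWeakPartial 0 v₁ d₁₀) (h₁₁ : HasWeakPartial 1 v₁ d₁₁)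
    (m₀ : MemLp v₀ 2) (m₀₀ : MemLp d₀₀ 2) (m₀₁ : MemLp d₀₁ 2) (m₁₀ : MemLp d₁₀ 2)
    (m₁₁ : MemLp d₁₁ 2) :
    ∫ x, (v₀ x - ∫ y, v₀ y) ^ 2
      ≤ (∫ x, (d₀₀ x - d₁₁ x) ^ 2) + ∫ x, (d₀₁ x + d₁₀ x) ^ 2 := by
  have i := fun {f : Torus → ℝ} (hf : MemLp f 2) (k : Fin 2 → ℤ) =>
    integrable_mFourier_mul (hf.integrable one_le_two) (-k)
  have s1 := hasSum_coef_sq (m₀₀.sub m₁₁)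
  have s2 := hasSum_coef_sq (m₀₁.add m₁₀)
  have s0 := hasSum_coef_sq (m₀.sub (memLp_const (∫ y, v₀ y)))
  have e1 : ∀ k, coef (d₀₀ - d₁₁) k = symb 0 k * coef v₀ k - symb 1 k * coef v₁ k := by
    intro k
    rw [← h₀₀.coef_eq, ← h₁₁.coef_eq]
    unfold coef
    rw [← integral_sub (i m₀₀ k) (i m₁₁ k)]
    congr 1; ext x; simp only [Pi.sub_apply]; push_cast; ring
  have e2 : ∀ k, coef (d₀₁ + d₁₀) k = symb 1 k * coef v₀ k + symb 0 k * coef v₁ k := by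
    intro k
    rw [← h₀₁.coef_eq, ← h₁₀.coef_eq]
    unfold coef
    rw [← integral_add (i m₀₁ k) (i m₁₀ k)]
    congr 1; ext x; simp only [Pi.add_apply]; push_cast; ring
  have ec : ∀ k, coef (v₀ - fun _ => ∫ y, v₀ y) k
      = if k = 0 then 0 else coef v₀ k := by
    intro k
    have h1 : coef (v₀ - fun _ => ∫ y, v₀ y) k
        = coef v₀ k - (∫ x : Torus, mFourier (-k) x) * ((∫ y, v₀ y : ℝ) : ℂ) := by
      unfold coef
      rw [← integral_mul_const, ← integral_sub (i m₀ k)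
        (i (memLp_const (∫ y, v₀ y)) k)]
      congr 1; ext x; simp only [Pi.sub_apply]; push_cast; ring
    rw [h1]
    split_ifs with hk
    · subst hk
      simp only [coef, neg_zero, mFourier_zero, ContinuousMap.one_apply, one_mul, integral_const,
        probReal_univ, one_smul]
      rw [integral_complex_ofReal, sub_self]
    · have hz : ∫ x : Torus, mFourier (-k) x = 0 := by simpa [coef] using coef_one_eq_zero hk
      rw [hz, zero_mul, sub_zero]
  refine hasSum_le (fun k => ?_) s0 (s1.add s2)
  rw [ec, e1, e2]
  split_ifs with hk
  · rw [norm_zero, zero_pow two_ne_zero]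
    positivity
  · have hk1 : (1 : ℝ) ≤ (k 0 : ℝ) ^ 2 + (k 1 : ℝ) ^ 2 := by
      have : (1 : ℤ) ≤ k 0 ^ 2 + k 1 ^ 2 := by
        by_contra hcon
        have h0 : k 0 ^ 2 = 0 := by nlinarith [sq_nonneg (k 0), sq_nonneg (k 1)]
        have h1 : k 1 ^ 2 = 0 := by nlinarith [sq_nonneg (k 0), sq_nonneg (k 1)]
        refine hk (funext fun j => ?_)
        fin_cases j
        · exact pow_eq_zero_iff two_ne_zero |>.1 h0
        · exact pow_eq_zero_iff two_ne_zero |>.1 h1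
      exact_mod_cast this
    have key : ‖symb 0 k * coef v₀ k - symb 1 k * coef v₁ k‖ ^ 2
        + ‖symb 1 k * coef v₀ k + symb 0 k * coef v₁ k‖ ^ 2
        = 4 * Real.pi ^ 2 * ((k 0 : ℝ) ^ 2 + (k 1 : ℝ) ^ 2) *
          (‖coef v₀ k‖ ^ 2 + ‖coef v₁ k‖ ^ 2) := by
      simp only [← Complex.normSq_eq_norm_sq, Complex.normSq_apply, symb]
      simp
      ring
    rw [key]
    have hπ := Real.pi_gt_three
    have h4 : 1 ≤ 4 * Real.pi ^ 2 * ((k 0 : ℝ) ^ 2 + (k 1 : ℝ) ^ 2) := by nlinarith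
    nlinarith [sq_nonneg ‖coef v₀ k‖, sq_nonneg ‖coef v₁ k‖]

theorem tendsto_integral_abs_trunc_sub {f : Torus → ℝ} (hf : MemLp f 2) :
    Tendsto (fun s => ∫ x, |trunc s f x - f x|) atTop (𝓝 0) := by
  have h1 : Tendsto (fun s => (eLpNorm (fun x => trunc s f x - f x) 2 volume).toReal) atTop (𝓝 0) := by
    exact (ENNReal.tendsto_toReal ENNReal.zero_ne_top).comp (tendsto_trunc hf)
  refine squeeze_zero (fun s => integral_nonneg fun x => abs_nonneg _) (fun s => ?_) h1
  have hm : MemLp (fun x => trunc s f x - f x) 2 := (memLp_trig _ _ _).sub hf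
  have h2 := eLpNorm_le_eLpNorm_of_exponent_le (p := 1) (q := 2) one_le_two hm.1
  refine le_trans (le_of_eq ?_) (ENNReal.toReal_mono hm.2.ne h2)
  rw [eLpNorm_one_eq_lintegral_enorm, ← integral_norm_eq_lintegral_enorm hm.1]
  rfl

theorem IsTest.sub_const {ψ : Torus → ℝ} (hψ : IsTest ψ) (c : ℝ) : IsTest (fun x => ψ x - c) :=
  ContDiff.sub hψ contDiff_const

theorem pd_sub_const (i : Fin 2) (ψ : Torus → ℝ) (c : ℝ) :
    pd i (fun x => ψ x - c) = pd i ψ := by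
  ext x; simp [pd]

theorem integrable_of_continuous {f : Torus → ℝ} (hf : Continuous f) : Integrable f :=
  ((BoundedContinuousFunction.mkOfCompact ⟨f, hf⟩).memLp_top.mono_exponent
    (p := 1) le_top).integrable le_rfl

theorem integral_integral_polarBox {p : Torus → ℝ} (hp : Continuous p) :
    ∫ x, ∫ z, p (x + polarT z) ∂polarBox = Real.pi * ∫ x, p x := by
  have hc : Continuous fun q : Torus × (ℝ × ℝ) => p (q.1 + polarT q.2) :=
    hp.comp (continuous_fst.add (continuous_polarT.comp continuous_snd))
  have hbd : ∃ C, ∀ x, ‖p x‖ ≤ C := by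
    obtain ⟨C, hC⟩ := (isCompact_univ (X := Torus)).exists_bound_of_continuousOn hp.continuousOn
    exact ⟨C, fun x => hC x (mem_univ x)⟩
  obtain ⟨C, hC⟩ := hbd
  have hint : Integrable (Function.uncurry fun (x : Torus) z => p (x + polarT z))
      (volume.prod polarBox) :=
    Integrable.of_bound hc.aestronglyMeasurable C (.of_forall fun q => hC _)
  rw [integral_integral_swap hint]
  simp only [integral_add_right_eq_self p]
  rw [integral_const, polarBox_real_univ, smul_eq_mul]

/-- A uniform Korn-type inequality: the trace-free part of the symmetric gradient, which is the
Cauchy-Riemann operator, controls the oscillation of a periodic field in `L^∞`. It follows from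
the disc-average bound for the partial Fourier sums, passing to the limit in `L¹`. -/
theorem ae_abs_sub_mean_le {v₀ v₁ d₀₀ d₀₁ d₁₀ d₁₁ : Torus → ℝ} {ε : ℝ} (hε : 0 ≤ ε)
    (h₀₀ : HasWeakPartial 0 v₀ d₀₀) (h₀₁ : HasWeakPartial 1 v₀ d₀₁)
    (h₁₀ : HasWeakPartial 0 v₁ d₁₀) (h₁₁ : HasWeakPartial 1 v₁ d₁₁)
    (m₀ : MemLp v₀ 2) (m₀₀ : MemLp d₀₀ 2) (m₀₁ : MemLp d₀₁ 2) (m₁₀ : MemLp d₁₀ 2)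
    (m₁₁ : MemLp d₁₁ 2) (ha : ∀ᵐ x, |d₀₀ x - d₁₁ x| ≤ 2 * ε) (hb : ∀ᵐ x, |d₀₁ x + d₁₀ x| ≤ 2 * ε) :
    ∀ᵐ x, |v₀ x - ∫ y, v₀ y| ≤ 8 * ε := by
  set m := ∫ y, v₀ y with hm
  set f : Torus → ℝ := fun x => v₀ x - m with hf
  have mf : MemLp f 2 := m₀.sub (memLp_const m)
  have if1 : Integrable fun x => |f x| := (mf.integrable one_le_two).abs
  have hL1 : ∫ x, |f x| ≤ 3 * ε := by
    have h1 := integral_sq_sub_mean_le h₀₀ h₀₁ h₁₀ h₁₁ m₀ m₀₀ m₀₁ m₁₀ m₁₁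
    have bd : ∀ {p : Torus → ℝ}, MemLp p 2 → (∀ᵐ x, |p x| ≤ 2 * ε) →
        ∫ x, p x ^ 2 ≤ (2 * ε) ^ 2 := by
      intro p mp hp
      have : ∫ x, p x ^ 2 ≤ ∫ x : Torus, (2 * ε) ^ 2 := by
        refine integral_mono_ae mp.integrable_sq (integrable_const _) ?_
        filter_upwards [hp] with x hx
        rw [← sq_abs]
        exact pow_le_pow_left₀ (abs_nonneg _) hx 2
      simpa using this
    have h2 := bd (m₀₀.sub m₁₁) ha
    have h3 := bd (m₀₁.add m₁₀) hb
    have h4 := abs_integral_mul_le (p := fun x => |f x|) (q := fun _ => 1) mf.abs (memLp_const 1)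
    simp only [mul_one, sq_abs, one_pow, integral_const, probReal_univ, smul_eq_mul,
      Real.sqrt_one] at h4
    refine (le_abs_self _).trans (h4.trans (Real.sqrt_le_iff.2 ⟨by positivity, ?_⟩))
    simp only [Pi.sub_apply, Pi.add_apply] at h2 h3
    simp only [hf]
    nlinarith
  set δ : (Torus → ℝ) → Finset (Fin 2 → ℤ) → ℝ := fun h s => ∫ x, |trunc s h x - h x| with hδ
  -- `8 ε` is twice the `L¹` bound `3 ε` plus the contribution `2 ε` of the disc
  have key : ∀ s, ∫ x, max (|f x| - 8 * ε) 0
      ≤ 3 * δ v₀ s + (1 / 2) * (δ d₀₀ s + δ d₁₁ s + δ d₀₁ s + δ d₁₀ s) := by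
    intro s
    have ct : ∀ h, Continuous (trunc s h) := fun h => continuous_trig _ _
    set F : Torus → ℝ := fun x => trunc s v₀ x - m with hF
    set a : Torus → ℝ := fun x => trunc s d₀₀ x - trunc s d₁₁ x with ha'
    set b : Torus → ℝ := fun x => trunc s d₀₁ x + trunc s d₁₀ x with hb'
    have cF : Continuous F := (ct v₀).sub continuous_const
    have ca : Continuous a := (ct _).sub (ct _)
    have cb : Continuous b := (ct _).add (ct _)
    -- partial Fourier sums need not keep the bound `2 ε`; the excess `p` is small in `L¹` only
    set p : Torus → ℝ := fun x => max (|a x| - 2 * ε) 0 + max (|b x| - 2 * ε) 0 with hp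
    have cp : Continuous p :=
      ((ca.abs.sub continuous_const).max continuous_const).add
        ((cb.abs.sub continuous_const).max continuous_const)
    have pd0 : ∀ x, pd 0 F x = trunc s d₀₀ x := fun x => by rw [hF, pd_sub_const]; exact h₀₀.pd_trunc s x
    have pd1 : ∀ x, pd 1 F x = trunc s d₀₁ x := fun x => by rw [hF, pd_sub_const]; exact h₀₁.pd_trunc s x
    have c0 : ∀ i, Continuous (pd i F) := by
      intro i
      fin_cases i
      · exact (funext pd0 : pd 0 F = _) ▸ ct _
      · exact (funext pd1 : pd 1 F = _) ▸ ct _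
    have c1 : ∀ i, Continuous (pd i (trunc s v₁)) := by
      intro i
      fin_cases i
      · exact (funext (h₁₀.pd_trunc s) : pd 0 (trunc s v₁) = _) ▸ ct _
      · exact (funext (h₁₁.pd_trunc s) : pd 1 (trunc s v₁) = _) ▸ ct _
    have hpt : ∀ x, |F x| ≤ 2 * (∫ y, |F y|) + 2 * ε
        + (∫ z, p (x + polarT z) ∂polarBox) / (2 * Real.pi) := by
      intro x
      have h1 := abs_le_integral_add ((isTest_trig s (coef v₀)).sub_const m)
        (isTest_trig s (coef v₁)) cF c0 c1 (a := a) (b := b)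
        (fun x => by rw [show pd 0 (fun x => trig s (coef v₀) x - m) x = _ from pd0 x,
          show pd 1 (trig s (coef v₁)) x = _ from h₁₁.pd_trunc s x])
        (fun x => by rw [show pd 1 (fun x => trig s (coef v₀) x - m) x = _ from pd1 x,
          show pd 0 (trig s (coef v₁)) x = _ from h₁₀.pd_trunc s x]) x
      have h2 : ∫ z, (|a (x + polarT z)| + |b (x + polarT z)|) ∂polarBox
          ≤ ∫ z, (4 * ε + p (x + polarT z)) ∂polarBox := by
        refine integral_mono (integrable_polarBox ((continuous_polarT_comp ca x).abs.add
          (continuous_polarT_comp cb x).abs)) (integrable_polarBox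
          (continuous_const.add (continuous_polarT_comp cp x))) fun z => ?_
        have e1 := le_max_left (|a (x + polarT z)| - 2 * ε) 0
        have e2 := le_max_left (|b (x + polarT z)| - 2 * ε) 0
        simp only [hp]
        linarith
      rw [integral_add (integrable_const _) (integrable_polarBox (continuous_polarT_comp cp x)),
        integral_const, polarBox_real_univ, smul_eq_mul] at h2
      have hπ := Real.pi_pos
      have h3 := div_le_div_of_nonneg_right h2 (show 0 ≤ 2 * Real.pi by positivity)
      rw [add_div, show Real.pi * (4 * ε) / (2 * Real.pi) = 2 * ε by field_simp; ring] at h3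
      have h4 : |F x| ≤ 2 * (∫ y, |F y|) + (∫ z, (|a (x + polarT z)| + |b (x + polarT z)|)
          ∂polarBox) / (2 * Real.pi) := h1
      linarith
    have iF : Integrable fun x => |F x| := integrable_of_continuous cF.abs
    have idiff : ∀ {h : Torus → ℝ}, MemLp h 2 → Integrable fun x => |trunc s h x - h x| :=
      fun mh => (((memLp_trig s _ 2).sub mh).integrable one_le_two).abs
    have hFf : ∀ x, |F x - f x| = |trunc s v₀ x - v₀ x| := fun x => by
      simp only [hF, hf]; congr 1; ring
    have hFL1 : ∫ x, |F x| ≤ 3 * ε + δ v₀ s := by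
      have : ∫ x, |F x| ≤ ∫ x, (|f x| + |trunc s v₀ x - v₀ x|) := by
        refine integral_mono iF (if1.add (idiff m₀)) fun x => ?_
        have := abs_sub_abs_le_abs_sub (F x) (f x)
        rw [hFf] at this
        simp only
        linarith
      rw [integral_add if1 (idiff m₀)] at this
      linarith
    have cI : Continuous fun x => ∫ z, p (x + polarT z) ∂polarBox := by
      obtain ⟨C, hC⟩ := (isCompact_univ (X := Torus)).exists_bound_of_continuousOn cp.continuousOn
      exact continuous_of_dominated
        (fun x => (continuous_polarT_comp cp x).aestronglyMeasurable)
        (fun x => .of_forall fun z => hC _ (mem_univ _)) (integrable_const C)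
        (.of_forall fun z => cp.comp (continuous_id.add continuous_const))
    have hpL1 : ∫ x, p x ≤ δ d₀₀ s + δ d₁₁ s + δ d₀₁ s + δ d₁₀ s := by
      simp only [hδ]
      rw [← integral_add (idiff m₀₀) (idiff m₁₁), ← integral_add ((idiff m₀₀).fun_add (idiff m₁₁))
        (idiff m₀₁), ← integral_add (((idiff m₀₀).fun_add (idiff m₁₁)).fun_add (idiff m₀₁)) (idiff m₁₀)]
      refine integral_mono_ae (integrable_of_continuous cp)
        ((((idiff m₀₀).fun_add (idiff m₁₁)).fun_add (idiff m₀₁)).fun_add (idiff m₁₀)) ?_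
      filter_upwards [ha, hb] with x hxa hxb
      have e1 : max (|a x| - 2 * ε) 0 ≤ |trunc s d₀₀ x - d₀₀ x| + |trunc s d₁₁ x - d₁₁ x| := by
        refine max_le ?_ (by positivity)
        have : a x = (d₀₀ x - d₁₁ x) + ((trunc s d₀₀ x - d₀₀ x) - (trunc s d₁₁ x - d₁₁ x)) := by
          simp only [ha']; ring
        have h1 := abs_add_le (d₀₀ x - d₁₁ x) ((trunc s d₀₀ x - d₀₀ x) - (trunc s d₁₁ x - d₁₁ x))
        have h2 := abs_sub (trunc s d₀₀ x - d₀₀ x) (trunc s d₁₁ x - d₁₁ x)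
        rw [← this] at h1
        linarith
      have e2 : max (|b x| - 2 * ε) 0 ≤ |trunc s d₀₁ x - d₀₁ x| + |trunc s d₁₀ x - d₁₀ x| := by
        refine max_le ?_ (by positivity)
        have : b x = (d₀₁ x + d₁₀ x) + ((trunc s d₀₁ x - d₀₁ x) + (trunc s d₁₀ x - d₁₀ x)) := by
          simp only [hb']; ring
        have h1 := abs_add_le (d₀₁ x + d₁₀ x) ((trunc s d₀₁ x - d₀₁ x) + (trunc s d₁₀ x - d₁₀ x))
        have h2 := abs_add_le (trunc s d₀₁ x - d₀₁ x) (trunc s d₁₀ x - d₁₀ x)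
        rw [← this] at h1
        linarith
      simp only [hp]
      linarith
    have j1 : Integrable fun x => (∫ z, p (x + polarT z) ∂polarBox) / (2 * Real.pi) :=
      integrable_of_continuous (cI.div_const _)
    have main : ∫ x, max (|f x| - 8 * ε) 0 ≤ ∫ x, (|trunc s v₀ x - v₀ x| + 2 * δ v₀ s
        + (∫ z, p (x + polarT z) ∂polarBox) / (2 * Real.pi)) := by
      refine integral_mono ((if1.sub (integrable_const (8 * ε))).pos_part)
        (((idiff m₀).add (integrable_const _)).add j1) fun x => ?_
      have hδ0 : 0 ≤ δ v₀ s := integral_nonneg fun x => abs_nonneg _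
      have hI0 : 0 ≤ ∫ z, p (x + polarT z) ∂polarBox := integral_nonneg fun z =>
        add_nonneg (le_max_right _ _) (le_max_right _ _)
      refine max_le ?_ (by positivity)
      have h1 := hpt x
      have h2 := abs_sub_abs_le_abs_sub (f x) (F x)
      rw [abs_sub_comm (f x), hFf] at h2
      linarith
    rw [integral_add ((idiff m₀).fun_add (integrable_const _)) j1,
      integral_add (idiff m₀) (integrable_const _), integral_const, probReal_univ, one_smul,
      integral_div, integral_integral_polarBox cp] at main
    have hπ := Real.pi_pos
    rw [show Real.pi * (∫ x, p x) / (2 * Real.pi) = (1 / 2) * ∫ x, p x by field_simp] at main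
    have : (∫ x, |trunc s v₀ x - v₀ x|) = δ v₀ s := rfl
    linarith
  have hlim : Tendsto (fun s => 3 * δ v₀ s + (1 / 2) * (δ d₀₀ s + δ d₁₁ s + δ d₀₁ s + δ d₁₀ s))
      atTop (𝓝 0) := by
    have := ((tendsto_integral_abs_trunc_sub m₀).const_mul 3).add
      (((((tendsto_integral_abs_trunc_sub m₀₀).add (tendsto_integral_abs_trunc_sub m₁₁)).add
      (tendsto_integral_abs_trunc_sub m₀₁)).add (tendsto_integral_abs_trunc_sub m₁₀)).const_mul
        (1 / 2))
    simpa using this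
  have hzero : ∫ x, max (|f x| - 8 * ε) 0 = 0 :=
    le_antisymm (ge_of_tendsto' hlim key) (integral_nonneg fun x => le_max_right _ _)
  have h2 := (integral_eq_zero_iff_of_nonneg (fun x => le_max_right (|f x| - 8 * ε) 0)
    ((if1.sub (integrable_const (8 * ε))).pos_part)).1 hzero
  filter_upwards [h2] with x hx
  have := le_max_left (|f x| - 8 * ε) 0
  rw [show max (|f x| - 8 * ε) 0 = 0 from hx] at this
  linarith

/-! ### The flow time scale of large eddies -/

theorem HasWeakPartial.neg {i : Fin 2} {f g : Torus → ℝ} (h : HasWeakPartial i f g) :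
    HasWeakPartial i (fun x => -f x) (fun x => -g x) := by
  refine ⟨h.1.neg, h.2.1.neg, fun ψ hψ => ?_⟩
  simp only [neg_mul, integral_neg, h.2.2 ψ hψ]

theorem ae_slab_of_ae_ae_norm_le {T c : ℝ} {u : ℝ → Torus → E2}
    (mu : AEStronglyMeasurable (Function.uncurry u) (slab T))
    (h : ∀ᵐ t ∂(volume.restrict (Ioo 0 T)), ∀ᵐ x, ‖u t x‖ ≤ c) :
    ∀ᵐ p ∂(slab T), ‖Function.uncurry u p‖ ≤ c := by
  have h1 : ∀ᵐ t ∂(volume.restrict (Ioo 0 T)), ∀ᵐ x, u t x = mu.mk _ (t, x) :=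
    Measure.ae_ae_of_ae_prod mu.ae_eq_mk
  have hmeas : MeasurableSet {p : ℝ × Torus | ‖mu.mk _ p‖ ≤ c} :=
    measurableSet_le mu.stronglyMeasurable_mk.measurable.norm measurable_const
  have h2 : ∀ᵐ p ∂(slab T), ‖mu.mk _ p‖ ≤ c := by
    refine (Measure.ae_prod_iff_ae_ae hmeas).2 ?_
    filter_upwards [h1, h] with t ht1 ht2
    filter_upwards [ht1, ht2] with x hx1 hx2
    rwa [← hx1]
  filter_upwards [h2, mu.ae_eq_mk] with p hp hp'
  rwa [hp']

/-- The splitting that the large eddy assumption provides is a competitor for the infimum. -/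
theorem flowRate_le_of_largeEddy {K ν T : ℝ} {u : ℝ → Torus → E2} (hK : 0 < K) (hν : 0 < ν)
    (h : LargeEddy K ν T u) : flowRate ν T u ≤ ENNReal.ofReal (6 * K) := by
  obtain ⟨v, D, hv, -, hD, hw⟩ := h
  have hw' : eLpNorm (fun p : ℝ × Torus => u p.1 p.2 - v p.1 p.2) ⊤ (slab T)
      ≤ ENNReal.ofReal (Real.sqrt (K * ν)) := by
    rw [← Real.sq_sqrt (show 0 ≤ K * ν by positivity),
      ENNReal.ofReal_pow (Real.sqrt_nonneg _)] at hw
    exact (ENNReal.pow_le_pow_left_iff two_ne_zero).1 hw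
  have hD' : ∀ᵐ p ∂(slab T), ∀ i j, |D p.1 p.2 i j| ≤ K :=
    ae_all_iff.2 fun i => ae_all_iff.2 fun j => ae_norm_le_of_eLpNorm_top_le hK.le (hD i j)
  unfold flowRate
  refine iInf_le_of_le v (iInf_le_of_le D (iInf_le_of_le hv (eLpNorm_top_le_ofReal ?_)))
  filter_upwards [hD', ae_norm_le_of_eLpNorm_top_le (Real.sqrt_nonneg _) hw'] with p hp hp'
  rw [Real.norm_of_nonneg (sigmaPlus_nonneg _)]
  refine sigmaPlus_Lam_le hν hp ?_
  calc ‖u p.1 p.2 - v p.1 p.2‖ ^ 2 ≤ Real.sqrt (K * ν) ^ 2 := pow_le_pow_left₀ (norm_nonneg _) hp' 2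
    _ = K * ν := Real.sq_sqrt (by positivity)

/-- If some splitting `u = v + (u - v)` has `σ⁺(Λ) ≤ ε`, then a mean-free velocity is small: the
small scales are, and the large scales are close to their mean, which is that of `v - u`. -/
theorem ae_norm_le_of_sigmaPlus_le {ν T ε : ℝ} {u v : ℝ → Torus → E2}
    {D : ℝ → Torus → Matrix (Fin 2) (Fin 2) ℝ} (hν : 0 < ν) (hε : 0 ≤ ε)
    (mu : MemLp (Function.uncurry u) ⊤ (slab T)) (hv : MemLinftyW1Vec T v D)
    (hΛ : ∀ᵐ p ∂(slab T), sigmaPlus (Lam ν (D p.1 p.2) (u p.1 p.2 - v p.1 p.2)) ≤ ε)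
    (hmean : ∀ᵐ t ∂(volume.restrict (Ioo 0 T)), ∫ x, u t x = 0) :
    ∀ᵐ p ∂(slab T), ‖Function.uncurry u p‖ ≤ 4 * Real.sqrt (4 * ε * ν) + 16 * ε := by
  have hvtop : ∀ᵐ t ∂(volume.restrict (Ioo 0 T)), ∀ i, MemLp (fun x => v t x i) ⊤ :=
    ae_all_iff.2 fun i => MemLp.ae_slice_top (hv i).1
  have hDtop : ∀ᵐ t ∂(volume.restrict (Ioo 0 T)), ∀ i j, MemLp (fun x => D t x i j) ⊤ :=
    ae_all_iff.2 fun i => by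
      filter_upwards [MemLp.ae_slice_top (hv i).2.1] with t ht j
      exact MemLp.apply_E2 ht j
  have hvgrad : ∀ᵐ t ∂(volume.restrict (Ioo 0 T)), ∀ i,
      HasWeakGrad (fun x => v t x i) (fun x => WithLp.toLp 2 (D t x i)) :=
    ae_all_iff.2 fun i => (hv i).2.2
  have hΛ' : ∀ᵐ t ∂(volume.restrict (Ioo 0 T)), ∀ᵐ x,
      sigmaPlus (Lam ν (D t x) (u t x - v t x)) ≤ ε := Measure.ae_ae_of_ae_prod hΛ
  refine ae_slab_of_ae_ae_norm_le mu.1 ?_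
  filter_upwards [hvtop, hDtop, hvgrad, hΛ', hmean, MemLp.ae_slice_top mu]
    with t mv mD gradv hΛ hmean mus
  set η := Real.sqrt (4 * ε * ν) with hη
  have hb : ∀ᵐ x, (∀ i, |u t x i - v t x i| ≤ η) ∧ |D t x 0 0 - D t x 1 1| ≤ 2 * ε
      ∧ |D t x 0 1 + D t x 1 0| ≤ 2 * ε := by
    filter_upwards [hΛ] with x hx
    obtain ⟨h1, h2, h3⟩ := bounds_of_sigmaPlus_Lam_le hν hx
    refine ⟨fun i => ?_, h2, h3⟩
    have h4 : ‖u t x - v t x‖ ≤ η := Real.le_sqrt_of_sq_le h1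
    have h5 := PiLp.norm_apply_le (u t x - v t x) i
    exact h5.trans h4
  have m2 : ∀ {f : Torus → ℝ}, MemLp f ⊤ → MemLp f 2 := fun h => h.mono_exponent le_top
  have p : ∀ i j, HasWeakPartial j (fun x => v t x i) (fun x => D t x i j) := fun i j => gradv i j
  have osc0 := ae_abs_sub_mean_le hε (p 0 0) (p 0 1) (p 1 0) (p 1 1) (m2 (mv 0)) (m2 (mD 0 0))
    (m2 (mD 0 1)) (m2 (mD 1 0)) (m2 (mD 1 1)) (by filter_upwards [hb] with x hx using hx.2.1)
    (by filter_upwards [hb] with x hx using hx.2.2)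
  -- rotating the field by a quarter turn exchanges the components
  have osc1 := ae_abs_sub_mean_le hε (p 1 0) (p 1 1) (p 0 0).neg (p 0 1).neg (m2 (mv 1))
    (m2 (mD 1 0)) (m2 (mD 1 1)) (m2 (mD 0 0)).neg (m2 (mD 0 1)).neg
    (by
      filter_upwards [hb] with x hx
      rw [sub_neg_eq_add, add_comm]; exact hx.2.2)
    (by
      filter_upwards [hb] with x hx
      rw [← sub_eq_add_neg, abs_sub_comm]; exact hx.2.1)
  have iu : ∀ i, Integrable fun x => u t x i := fun i =>
    (m2 (MemLp.apply_E2 mus i)).integrable one_le_two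
  have iv : ∀ i, Integrable fun x => v t x i := fun i => (m2 (mv i)).integrable one_le_two
  have mean : ∀ i, |∫ x, v t x i| ≤ η := by
    intro i
    have hu0 : ∫ x, u t x i = 0 := by
      have := (EuclideanSpace.proj (𝕜 := ℝ) i : E2 →L[ℝ] ℝ).integral_comp_comm
        ((mus.mono_exponent (p := 1) le_top).integrable le_rfl)
      rw [hmean, map_zero] at this
      exact this
    have h1 : ∫ x, v t x i = - ∫ x, (u t x i - v t x i) := by
      rw [integral_sub (iu i) (iv i), hu0]; ring
    rw [h1, abs_neg]
    have := norm_integral_le_of_norm_le_const (μ := (volume : Measure Torus))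
      (f := fun x => u t x i - v t x i) (C := η) (by filter_upwards [hb] with x hx using hx.1 i)
    simpa using this
  filter_upwards [hb, osc0, osc1] with x hx h0 h1
  have comp : ∀ i, |v t x i - ∫ y, v t y i| ≤ 8 * ε → |u t x i| ≤ 2 * η + 8 * ε := by
    intro i h
    have e : u t x i = (u t x i - v t x i) + ((v t x i - ∫ y, v t y i) + ∫ y, v t y i) := by ring
    rw [e]
    refine (abs_add_le _ _).trans ?_
    have := abs_add_le (v t x i - ∫ y, v t y i) (∫ y, v t y i)
    linarith [hx.1 i, mean i]
  have c0 := comp 0 h0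
  have c1 := comp 1 h1
  have hn : ‖u t x‖ ≤ |u t x 0| + |u t x 1| := by
    refine abs_le_of_sq_le_sq' ?_ (by positivity) |>.2
    rw [E2.norm_sq]
    nlinarith [sq_abs (u t x 0), sq_abs (u t x 1),
      mul_nonneg (abs_nonneg (u t x 0)) (abs_nonneg (u t x 1))]
  linarith

theorem flowTime_bounds_of_largeEddy {K : ℝ} (hK : 0 < K) : ∃ C : ℝ, 0 < C ∧
    ∀ (ν T : ℝ), 0 < ν → 0 < T → ∀ u : ℝ → Torus → E2,
      MemLp (Function.uncurry u) ⊤ (slab T) → LargeEddy K ν T u →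
      ENNReal.ofReal C⁻¹ ≤ flowTime ν T u ∧
      ((∀ᵐ t ∂(volume.restrict (Ioo 0 T)), ∫ x, u t x = 0) →
        ENNReal.ofReal K⁻¹ ≤ eLpNorm (Function.uncurry u) ⊤ (slab T) →
        ν ≤ K → flowTime ν T u ≤ ENNReal.ofReal C) := by
  -- with `ε = 1 / C`, the bound `4 √(4 ε K) + 16 ε` on `|u|` is at most `1 / (2 K)`
  set C : ℝ := 6 * K + 1024 * K ^ 3 + 64 * K with hC
  have hC0 : 0 < C := by positivity
  refine ⟨C, hC0, fun ν T hν _ u mu hLE => ⟨?_, fun hmean hbig hνK => ?_⟩⟩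
  · rw [flowTime, ENNReal.ofReal_inv_of_pos hC0]
    refine ENNReal.inv_le_inv.2 ((flowRate_le_of_largeEddy hK hν hLE).trans
      (ENNReal.ofReal_le_ofReal ?_))
    have : 0 < K ^ 3 := by positivity
    linarith
  · by_contra hcon
    rw [not_le, flowTime, ENNReal.lt_inv_iff_lt_inv, ← ENNReal.ofReal_inv_of_pos hC0] at hcon
    unfold flowRate at hcon
    simp only [iInf_lt_iff] at hcon
    obtain ⟨v, D, hv, hlt⟩ := hcon
    have hε : 0 ≤ C⁻¹ := by positivity
    have hsmall := ae_norm_le_of_sigmaPlus_le hν hε mu hv (by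
      filter_upwards [ae_norm_le_of_eLpNorm_top_le hε hlt.le] with p hp
      exact (le_abs_self _).trans hp) hmean
    have h1 := hbig.trans (eLpNorm_top_le_ofReal hsmall)
    have hb : 4 * Real.sqrt (4 * C⁻¹ * ν) + 16 * C⁻¹ ≤ (1 / 2) * K⁻¹ := by
      have hK3 : 0 < K ^ 3 := by positivity
      have e1 : C⁻¹ ≤ (1024 * K ^ 3)⁻¹ := inv_anti₀ (by positivity) (by linarith)
      have e2 : C⁻¹ ≤ (64 * K)⁻¹ := inv_anti₀ (by positivity) (by linarith)
      have e3 : Real.sqrt (4 * C⁻¹ * ν) ≤ (1 / 16) * K⁻¹ := by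
        refine Real.sqrt_le_iff.2 ⟨by positivity, ?_⟩
        calc 4 * C⁻¹ * ν ≤ 4 * (1024 * K ^ 3)⁻¹ * K := by gcongr
          _ = ((1 / 16) * K⁻¹) ^ 2 := by field_simp; norm_num
      have e4 : 16 * (64 * K)⁻¹ = (1 / 4) * K⁻¹ := by field_simp; norm_num
      linarith
    have hKi : 0 < K⁻¹ := by positivity
    have h2 := (ENNReal.ofReal_le_ofReal_iff (by positivity)).1 h1
    linarith

end DualStab

theorem mainTheorem2 :
    (∃ C : ℝ, 0 < C ∧
      ∀ (ν T : ℝ), 0 < ν → 0 < T →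
      ∀ (u : ℝ → DualStab.Torus → DualStab.E2)
        (ωh : ℝ → DualStab.Torus → ℝ) (gω : ℝ → DualStab.Torus → DualStab.E2)
        (ξ : DualStab.Torus → ℝ) (gξ : DualStab.Torus → DualStab.E2)
        (φ₁ w : ℝ → DualStab.Torus → ℝ) (g₁ : ℝ → DualStab.Torus → DualStab.E2)
        (H₁ : ℝ → DualStab.Torus → Matrix (Fin 2) (Fin 2) ℝ)
        (φ₂ : ℝ → DualStab.Torus → ℝ) (g₂ : ℝ → DualStab.Torus → DualStab.E2),
        MemLp (Function.uncurry u) ⊤ (DualStab.slab T) →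
        DualStab.MemLinftyW1 T ωh gω →
        DualStab.HasWeakGrad ξ gξ → MemLp gξ 2 →
        DualStab.IsDualSolution ν T u gω ξ φ₁ w g₁ H₁ φ₂ g₂ →
        ((⨆ t ∈ Ioo 0 T, eLpNorm (g₁ t) 2 volume)
            + ENNReal.ofReal (Real.sqrt ν) *
              eLpNorm (fun p : ℝ × DualStab.Torus =>
                Real.sqrt (∑ i : Fin 2, ∑ j : Fin 2, H₁ p.1 p.2 i j ^ 2)) 2 (DualStab.slab T)
          ≤ ENNReal.ofReal C * DualStab.growth ν T u * eLpNorm gξ 2 volume) ∧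
        ((∫⁻ t in Ioo 0 T, eLpNorm (g₂ t) 2 volume)
          ≤ DualStab.growth ν T u * (∫⁻ t in Ioo 0 T, eLpNorm (ωh t) ⊤ volume)
              * eLpNorm gξ 2 volume)) ∧
    (∀ K : ℝ, 0 < K → ∃ C : ℝ, 0 < C ∧
      ∀ (ν T : ℝ), 0 < ν → 0 < T →
      ∀ u : ℝ → DualStab.Torus → DualStab.E2,
        MemLp (Function.uncurry u) ⊤ (DualStab.slab T) →
        DualStab.LargeEddy K ν T u →
        ENNReal.ofReal C⁻¹ ≤ DualStab.flowTime ν T u ∧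
        ((∀ᵐ t ∂(volume.restrict (Ioo 0 T)), ∫ x, u t x = 0) →
          ENNReal.ofReal K⁻¹ ≤ eLpNorm (Function.uncurry u) ⊤ (DualStab.slab T) →
          ν ≤ K →
          DualStab.flowTime ν T u ≤ ENNReal.ofReal C)) := by
  refine ⟨⟨2, two_pos, ?_⟩, fun K hK => DualStab.flowTime_bounds_of_largeEddy hK⟩
  intro ν T hν hT u ωh gω ξ gξ φ₁ w g₁ H₁ φ₂ g₂ mu hω hξ mξ hS
  exact hS.stability hν hT mu hω hξ mξ
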